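/- Let $F$ be a totally real number field, $K$ a totally complex quadratic extension of $F$, and $\iota$ the generator of $\mathrm{Gal}(K/F)$. Let $q\in F$ be such that $K=F(\sqrt{-q})$, with a fixed square root $\sqrt{-q}\in K$. Let $X$ be a complex abelian variety with a unital homomorphism $\hat\eta:F\to \mathrm{End}(X)\otimes\mathbb Q$, let $\hat X$ be its dual, and $d=\dim_F H^1(X,\mathbb Q)$. Let $\Theta\in\wedge^2_F H^1(X,\mathbb Q)$ be a polarization; that is, $\Theta$ is an alternating $F$-bilinear form $H_1(X,\mathbb Q)\times H_1(X,\mathbb Q)\to F$ such that the rational form $\mathrm{tr}_{F/\mathbb Q}\circ\Theta$ is the class of type $(1,1)$ of a (rational) polarization of $X$. Put $V_{\mathbb Q}=H^1(X,\mathbb Q)\oplus H^1(\hat X,\mathbb Q)$, where $H^1(\hat X,\mathbb Q)=H^1(X,\mathbb Q)^*=H_1(X,\mathbb Q)$ and $H^1(X,\mathbb Q)$ is identified with $\mathrm{Hom}_F(H_1(X,\mathbb Q),F)$ by the trace. Let $((h,m),(h',m'))_{V_{\hat\eta}}=h(m')+h'(m)\in F$ and $(x,y)_V=\mathrm{tr}_{F/\mathbb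 Q}(x,y)_{V_{\hat\eta}}$. Let $C(V)$ be the Clifford algebra with $vw+wv=(v,w)_V$, acting on $S=\wedge^*H^1(X,\mathbb Q)=H^*(X,\mathbb Q)$ so that $H^1(X)$ acts by wedge product and $H^1(\hat X)$ by contraction. $\mathrm{Spin}(V_{\mathbb R})$ acts on $V_{\mathbb R}$ by $\rho_g(v)=gvg^{-1}$. Let $W\subset V_{\mathbb Q}\otimes_F K$ be the image of $H^1(\hat X,\mathbb Q)\otimes_FK$ under $(h,m)\mapsto (h-\sqrt{-q}\,\Theta(m,\cdot),m)$ (extended $K$-linearly), and $\bar W$ its image under $\mathrm{id}\otimes\iota$. There is a unique $F$-algebra homomorphism $\eta:K\to\mathrm{End}_F(V_{\mathbb Q})$ such that $\eta_s$ acts on $W$ as multiplication by $s$ and on $\bar W$ as multiplication by $\iota(s)$, for all $s\in K$. For an embedding $\sigma:K\to\mathbb C$ let $V_{\sigma,\mathbb C}\subset V_{\mathbb C}$ be the subspace where every $\eta_s$ acts by $\sigma(s)$. A CM-type $T$ chooses an extension $T(\hat\sigma):K\to\mathbb C$ of each embedding $\hat\sigma:F\to\mathbb R$; put $W_T=\bigoplus_{\hat\sigma}V_{T(\hat\sigma),\mathbb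 C}$, let $\ell_T\subset S_{\mathbb C}$ be the line annihilated by $W_T$, and let $B\subset S$ be the rational subspace with $B\otimes\mathbb C=\sum_T\ell_T$. Let $\mathrm{Spin}(V_{\mathbb R})_B$ be the pointwise stabilizer of $B$. For $t\in K$ with $\iota(t)=-t$ put $\Xi_t(x,y)=(\eta_t(x),y)_V$ and let $\Omega_{B,t}$ be the set of all $I\in\rho(\mathrm{Spin}(V_{\mathbb R})_B)$ such that $I^2=-1$, for each embedding $\sigma:K\to\mathbb C$ the $i$- and $(-i)$-eigenspaces of $I$ in $V_{\sigma,\mathbb C}$ both have dimension $d/2$, and the symmetric form $g_I(x,y)=\Xi_t(x,I(y))$ is positive definite on $V_{\mathbb R}$. Let $H_t(x,y)=-t^2(x,y)_{V_{\hat\eta}}+t\,(\eta_t(x),y)_{V_{\hat\eta}}$, a $K$-valued hermitian form on the $K$-vector space $V_{\mathbb Q}$ (via $\eta$). Then there is a non-zero $t\in K$ with $\iota(t)=-t$ such that the complex structure $I=I_{X\times\hat X}$ of $X\times\hat X$ (acting on $V_{\mathbb R}=H^1(X\times\hat X,\mathbb R)$) belongs to $\Omega_{B,t}$. Moreover, for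 this $t$, $(X\times\hat X,\eta,\Xi_t)$ is a polarized abelian variety of Weil type: $I$ commutes with $\eta(K)$; for each $\sigma$ the $(\pm i)$-eigenspaces of $I$ in $V_{\sigma,\mathbb C}$ have dimension $d/2$; $\Xi_t$ is alternating and $I$-invariant, $\Xi_t(x,I(x))>0$ for $x\neq0$, and $\Xi_t(\eta_s(x),y)=\Xi_t(x,\eta_{\iota(s)}(y))$ for all $s\in K$. And it is of split type: $V_{\mathbb Q}$ contains an $H_t$-isotropic $K$-subspace of dimension $\frac12\dim_KV_{\mathbb Q}$, and for some $H_t$-orthogonal $K$-basis $b_1,\dots,b_d$ the values $c_i=H_t(b_i,b_i)\in F^\times$ are such that, for each embedding $\hat\sigma:F\to\mathbb R$, as many of the $\hat\sigma(c_i)$ are positive as negative, and $\prod_ic_i$ equals $(-1)^{d/2}$ modulo $\mathrm{Nm}_{K/F}(K^\times)$. -/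

import Mathlib

open scoped TensorProduct
open NumberField

noncomputable section
namespace WeilType
section CM
variable (F K : Type*) [Field F] [NumberField F] [IsTotallyReal F] [Field K] [NumberField K]
  [IsTotallyComplex K] [Algebra F K] [Algebra.IsQuadraticExtension F K]

/-- The involution `ι` of `K` over `F`: complex conjugation of the CM field `K`. -/
def iota : K ≃ₐ[F] K :=
  haveI : IsCMField K := IsCMField.ofCMExtension F K
  AlgEquiv.ofRingEquiv (f := (IsCMField.complexConj K).toRingEquiv) (fun a => by
    have h := CMExtension.equivMaximalRealSubfield_apply F K a
    change IsCMField.complexConj K (algebraMap F K a) = _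
    rw [← h]
    exact IsCMField.complexConj_apply_eq_self K _)

theorem embedding_iota (σ : K →+* ℂ) (x : K) :
    σ (iota F K x) = (starRingEnd ℂ) (σ x) := by
  have : IsCMField K := IsCMField.ofCMExtension F K
  exact IsCMField.complexEmbedding_complexConj K σ x

theorem iota_ne_one : iota F K ≠ AlgEquiv.refl := by
  have : IsCMField K := IsCMField.ofCMExtension F K
  intro h
  apply IsCMField.complexConj_ne_one K
  ext x
  exact congrArg (fun f : K ≃ₐ[F] K => f x) h

/-- An element `q` of `F` with a root `r = √-q` in `K`, such that `K = F(√-q)`. -/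
structure ImagGenerator where
  q : F
  r : K
  sq : r ^ 2 = -algebraMap F K q
  gen : IntermediateField.adjoin F {r} = ⊤

namespace ImagGenerator
variable {F K} (D : ImagGenerator F K)

theorem r_notMem : ∀ a : F, algebraMap F K a ≠ D.r := by
  intro a ha
  have h1 : IntermediateField.adjoin F {D.r} = ⊥ := by
    rw [IntermediateField.adjoin_simple_eq_bot_iff, ← ha]
    exact IntermediateField.algebraMap_mem _ _
  have h2 : Module.finrank F K = 1 := by
    rw [← IntermediateField.bot_eq_top_iff_finrank_eq_one, ← h1, D.gen]
  rw [Algebra.IsQuadraticExtension.finrank_eq_two F K] at h2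
  omega

theorem linInd : LinearIndependent F ![(1 : K), D.r] := by
  rw [LinearIndependent.pair_iff]
  intro s t h
  have ht : t = 0 := by
    by_contra ht
    apply D.r_notMem (-s / t)
    have : algebraMap F K t ≠ 0 := by simpa using ht
    rw [Algebra.smul_def, Algebra.smul_def] at h
    rw [map_div₀, map_neg, div_eq_iff this]
    linear_combination -h
  subst ht
  simpa using h

/-- The `F`-basis `1, r` of `K`. -/
def basis : Module.Basis (Fin 2) F K :=
  basisOfLinearIndependentOfCardEqFinrank D.linInd
    (by simp [Algebra.IsQuadraticExtension.finrank_eq_two F K])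

theorem basis_zero : D.basis 0 = 1 := by simp [basis]
theorem basis_one : D.basis 1 = D.r := by simp [basis]

theorem exists_coords (k : K) : ∃ a b : F, k = algebraMap F K a + algebraMap F K b * D.r := by
  refine ⟨D.basis.repr k 0, D.basis.repr k 1, ?_⟩
  have := D.basis.sum_repr k
  rw [Fin.sum_univ_two, basis_zero, basis_one, Algebra.smul_def, Algebra.smul_def] at this
  rw [mul_one] at this
  exact this.symm

theorem repr_coords (a b : F) :
    D.basis.repr (algebraMap F K a + algebraMap F K b * D.r) =
      Finsupp.single 0 a + Finsupp.single 1 b := by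
  have : algebraMap F K a + algebraMap F K b * D.r = a • D.basis 0 + b • D.basis 1 := by
    rw [basis_zero, basis_one, Algebra.smul_def, Algebra.smul_def, mul_one]
  rw [this]; simp

theorem iota_r : iota F K D.r = -D.r := by
  have h : (iota F K D.r) ^ 2 = D.r ^ 2 := by
    rw [← map_pow, D.sq, map_neg, AlgEquiv.commutes]
  rcases sq_eq_sq_iff_eq_or_eq_neg.mp h with h | h
  · exfalso
    apply iota_ne_one F K
    ext k
    obtain ⟨a, b, rfl⟩ := D.exists_coords k
    simp [h]
  · exact h

/-- The `F`-algebra homomorphism out of `K` sending `r` to a given square root of `-q`. -/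
def lift {R : Type*} [Ring R] [Algebra F R] (N : R) (hN : N * N = -algebraMap F R D.q) :
    K →ₐ[F] R :=
  AlgHom.ofLinearMap (D.basis.constr F ![1, N])
    (by rw [← D.basis_zero, Module.Basis.constr_basis]; rfl)
    (by
      have key : ∀ a b : F, D.basis.constr F ![1, N] (algebraMap F K a + algebraMap F K b * D.r) =
          algebraMap F R a + algebraMap F R b * N := by
        intro a b
        have : algebraMap F K a + algebraMap F K b * D.r = a • D.basis 0 + b • D.basis 1 := by
          rw [basis_zero, basis_one, Algebra.smul_def, Algebra.smul_def, mul_one]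
        rw [this, map_add, map_smul, map_smul, Module.Basis.constr_basis,
          Module.Basis.constr_basis]
        simp [Algebra.smul_def]
      intro x y
      obtain ⟨a, b, rfl⟩ := D.exists_coords x
      obtain ⟨c, d, rfl⟩ := D.exists_coords y
      have e : (algebraMap F K a + algebraMap F K b * D.r) *
          (algebraMap F K c + algebraMap F K d * D.r) =
          algebraMap F K (a * c - D.q * b * d) + algebraMap F K (a * d + b * c) * D.r := by
        simp only [map_sub, map_mul, map_add]
        linear_combination (algebraMap F K b * algebraMap F K d) * D.sq
      rw [e, key, key, key]
      have h1 : algebraMap F R b * N * (algebraMap F R d * N) =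
          -algebraMap F R (D.q * b * d) := by
        rw [mul_assoc, ← mul_assoc N, ← Algebra.commutes d N, mul_assoc, hN]
        simp only [map_mul, mul_neg]
        rw [← map_mul, ← map_mul, ← map_mul, ← map_mul]
        congr 2
        ring
      have h2 : algebraMap F R a * (algebraMap F R d * N) = algebraMap F R (a * d) * N := by
        rw [map_mul, mul_assoc]
      have h3 : algebraMap F R b * N * algebraMap F R c = algebraMap F R (b * c) * N := by
        rw [mul_assoc, ← Algebra.commutes c N, map_mul, mul_assoc]
      rw [add_mul, mul_add, mul_add, h1, h2, h3, map_sub, map_add, map_mul, add_mul]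
      abel)

theorem lift_r {R : Type*} [Ring R] [Algebra F R] (N : R) (hN : N * N = -algebraMap F R D.q) :
    D.lift N hN D.r = N := by
  conv_lhs => rw [← D.basis_one]
  change D.basis.constr F ![1, N] (D.basis 1) = N
  rw [Module.Basis.constr_basis]; rfl

theorem algHom_ext' {R : Type*} [Ring R] [Algebra F R] {f g : K →ₐ[F] R} (h : f D.r = g D.r) :
    f = g := by
  ext k
  obtain ⟨a, b, rfl⟩ := D.exists_coords k
  simp [h]

end ImagGenerator
end CM

section TraceDual
variable (F M : Type*) [Field F] [NumberField F] [AddCommGroup M] [Module ℚ M] [Module F M]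

/-- The trace identification `Hom_F(M, F) → Hom_ℚ(M, ℚ)`; it is bijective, see
`traceDual_bijective`. -/
def traceDual : Module.Dual F M →ₗ[ℚ] Module.Dual ℚ M where
  toFun h := (Algebra.trace ℚ F) ∘ₗ h.restrictScalars ℚ
  map_add' _ _ := by ext; simp
  map_smul' _ _ := by ext; simp

variable {F M}
@[simp] theorem traceDual_apply (h : Module.Dual F M) (m : M) :
    traceDual F M h m = Algebra.trace ℚ F (h m) := rfl

theorem trace_mul_left_injective {a b : F}
    (h : ∀ c : F, Algebra.trace ℚ F (c * a) = Algebra.trace ℚ F (c * b)) : a = b := by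
  have h0 : (Algebra.traceForm ℚ F).toDual (traceForm_nondegenerate ℚ F) a =
      (Algebra.traceForm ℚ F).toDual (traceForm_nondegenerate ℚ F) b := by
    ext c
    simpa [LinearMap.BilinForm.toDual_def, Algebra.traceForm_apply, mul_comm] using h c
  exact LinearEquiv.injective _ h0

theorem traceDual_bijective : Function.Bijective (traceDual F M) := by
  constructor
  · intro h k hk
    ext m
    apply trace_mul_left_injective
    intro c
    have := congrArg (fun f => f (c • m)) hk
    simpa using this
  · intro φ
    let D := (Algebra.traceForm ℚ F).toDual (traceForm_nondegenerate ℚ F)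
    let ψ : M → Module.Dual ℚ F := fun m => φ ∘ₗ (LinearMap.toSpanSingleton F M m).restrictScalars ℚ
    have hD : ∀ a c, D a c = Algebra.trace ℚ F (a * c) := fun a c => by
      simp [D, LinearMap.BilinForm.toDual_def, Algebra.traceForm_apply]
    have hDs : ∀ (f : Module.Dual ℚ F) (c : F), Algebra.trace ℚ F (c * D.symm f) = f c := by
      intro f c
      rw [mul_comm, ← hD, LinearEquiv.apply_symm_apply]
    refine ⟨{ toFun := fun m => D.symm (ψ m), map_add' := ?_, map_smul' := ?_ }, ?_⟩
    · intro x y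
      apply trace_mul_left_injective
      intro c
      rw [hDs, mul_add, map_add, hDs, hDs]
      simp [ψ]
    · intro a x
      apply trace_mul_left_injective
      intro c
      rw [hDs, RingHom.id_apply, smul_eq_mul, ← mul_assoc, hDs]
      simp [ψ, mul_smul]
    · ext m
      have := hDs (ψ m) 1
      simpa [ψ] using this
end TraceDual

section
variable (F M : Type*) [Field F] [NumberField F] [AddCommGroup M] [Module ℚ M] [Module F M] [Module.Finite ℚ M]

/-- `V_ℚ = H¹(X, ℚ) ⊕ H¹(X̂, ℚ)` for `M = H₁(X, ℚ)`: here `H¹(X, ℚ) = Hom_ℚ(M, ℚ)` is written as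
`Hom_F(M, F)` through the trace, and `H¹(X̂, ℚ) = H¹(X, ℚ)^* = M`. -/
abbrev V := Module.Dual F M × M

/-- The `F`-valued pairing `((h, m), (h', m'))_{V_η̂} = h m' + h' m`. -/
abbrev Fpair : LinearMap.BilinForm F (V F M) := LinearMap.dualProd F M

/-- The quadratic form `(v, v)_V / 2` of the rational pairing, `(h, m) ↦ tr_{F/ℚ}(h m)`, so that
`v w + w v = (v, w)_V` in the Clifford algebra. -/
def Q : QuadraticForm ℚ (V F M) :=
  (Algebra.trace ℚ F).compQuadraticMap' (QuadraticForm.dualProd F M)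

/-- The spin representation `S = H^*(X, ℚ) = ∧^* H¹(X, ℚ)`. -/
abbrev S := ExteriorAlgebra ℚ (Module.Dual F M)

/-- The evaluation `H₁(X, ℚ) → H¹(X, ℚ)^*`. -/
def evalTr : M →ₗ[ℚ] Module.Dual ℚ (Module.Dual F M) := (traceDual F M).flip

/-- The action of `V` on `S`: `H¹(X)` acts by wedge product and `H¹(X̂)` by contraction. -/
def spinMap : V F M →ₗ[ℚ] Module.End ℚ (S F M) :=
  (LinearMap.mul ℚ (S F M)) ∘ₗ (ExteriorAlgebra.ι ℚ) ∘ₗ LinearMap.fst ℚ _ _ +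
    CliffordAlgebra.contractLeft ∘ₗ evalTr F M ∘ₗ LinearMap.snd ℚ _ _

theorem spinMap_sq (v : V F M) :
    spinMap F M v * spinMap F M v = algebraMap ℚ _ (Q F M v) := by
  obtain ⟨h, m⟩ := v
  refine LinearMap.ext fun s => ?_
  have e : ∀ s : S F M, spinMap F M (h, m) s = ExteriorAlgebra.ι ℚ h * s +
      CliffordAlgebra.contractLeft (evalTr F M m) s := fun s => by simp [spinMap]
  have h1 : ExteriorAlgebra.ι ℚ h * ExteriorAlgebra.ι ℚ h = 0 :=
    ExteriorAlgebra.ι_sq_zero h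
  have h2 := CliffordAlgebra.contractLeft_ι_mul (Q := (0 : QuadraticForm ℚ (Module.Dual F M)))
    (evalTr F M m) h s
  have h3 := CliffordAlgebra.contractLeft_contractLeft
    (Q := (0 : QuadraticForm ℚ (Module.Dual F M))) (d := evalTr F M m) s
  have h4 : evalTr F M m h = Q F M (h, m) := by simp [evalTr, Q]
  rw [Module.End.mul_apply, e, e, mul_add, ← mul_assoc, h1, map_add, h3]
  change 0 * s + CliffordAlgebra.ι 0 h * _ + (CliffordAlgebra.contractLeft (evalTr F M m)
    (CliffordAlgebra.ι 0 h * s) + 0) = _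
  rw [h2, h4, Module.algebraMap_end_apply]
  simp

/-- The representation of the Clifford algebra `C(V)` on `S`. -/
def spinRep : CliffordAlgebra (Q F M) →ₐ[ℚ] Module.End ℚ (S F M) :=
  CliffordAlgebra.lift (Q F M) ⟨spinMap F M, spinMap_sq F M⟩

variable (A : Type*) [Field A] [Algebra ℚ A] 

/-- `V_A = A ⊗ V` for a field `A` of characteristic zero. -/
abbrev VA := A ⊗[ℚ] (V F M)
/-- The quadratic form on `V_A`. -/
abbrev QA : QuadraticForm A (VA F M A) := (Q F M).baseChange A

/-- The representation of `C(V_A)` on `A ⊗ S`. -/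
def spinRepA  :
    CliffordAlgebra (QA F M A) →ₐ[A] Module.End A (A ⊗[ℚ] (S F M)) :=
  (Algebra.TensorProduct.lift (Algebra.ofId A _)
    ((Module.End.baseChangeHom ℚ A (S F M)).comp (spinRep F M))
    (fun a _ => Algebra.commutes a _)).comp
    (CliffordAlgebra.equivBaseChange A (Q F M)).toAlgHom

/-- `H¹(X, ℝ) = Hom_ℝ(H₁(X, ℝ), ℝ)`. -/
def realDual : ℝ ⊗[ℚ] Module.Dual F M ≃ₗ[ℝ] Module.Dual ℝ (ℝ ⊗[ℚ] M) :=
  (LinearEquiv.baseChange ℚ ℝ _ _ (LinearEquiv.ofBijective (traceDual F M) traceDual_bijective)) ≪≫ₗ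
    (TensorProduct.isBaseChange ℚ M ℝ).toDualBaseChange

/-- The complexification of an endomorphism of `V_ℝ`, on `V_ℂ`. -/
def complexify {V : Type*} [AddCommGroup V] [Module ℚ V] (f : Module.End ℝ (ℝ ⊗[ℚ] V)) : Module.End ℂ (ℂ ⊗[ℚ] V) :=
  (TensorProduct.AlgebraTensorModule.cancelBaseChange ℚ ℝ ℂ ℂ V).conj (f.baseChange ℂ)

end


/-! ### Complex tori with multiplication by `F`, and polarizations in `∧²_F H¹` -/

section Torus
variable (F M : Type*) [Field F] [NumberField F] [AddCommGroup M] [Module ℚ M] [Module F M]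
  [Module.Finite ℚ M]

/-- The complex torus `X = (ℝ ⊗ M) / Λ` with `M = H₁(X, ℚ)`, its lattice `Λ = H₁(X, ℤ)`, its complex
structure `J`, and an embedding of `F` in `End(X) ⊗ ℚ` (the `F`-module structure of `M`, whose
elements commute with `J`). -/
structure Torus where
  lattice : Submodule ℤ M
  lattice_fg : lattice.FG
  span_lattice : Submodule.span ℚ (lattice : Set M) = ⊤
  J : Module.End ℝ (ℝ ⊗[ℚ] M)
  J_mul_J : J * J = -1
  J_comm : ∀ a : F, Commute J (((LinearMap.lsmul F M a).restrictScalars ℚ).baseChange ℝ)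

variable {F M}

/-- The rational alternating form `tr_{F/ℚ} ∘ Θ` on `H₁(X, ℚ)` attached to an `F`-bilinear form. -/
def riemannForm (Θ : M →ₗ[F] M →ₗ[F] F) : LinearMap.BilinForm ℚ M :=
  LinearMap.mk₂ ℚ (fun x y => Algebra.trace ℚ F (Θ x y))
    (fun x y z => by simp) (fun c x y => by
      rw [LinearMap.map_smul_of_tower, LinearMap.smul_apply, map_smul])
    (fun x y z => by simp) (fun c x y => by rw [LinearMap.map_smul_of_tower, map_smul])

/-- A (rational) polarization of `X` lying in `∧²_F H¹(X, ℚ)`: an alternating `F`-bilinear form on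
`H₁(X, ℚ)` whose trace is of type `(1,1)` and positive. -/
structure Polarization (X : Torus F M) where
  form : M →ₗ[F] M →ₗ[F] F
  alt : form.IsAlt
  invariant : ∀ x y, (riemannForm form).baseChange ℝ (X.J x) (X.J y) =
    (riemannForm form).baseChange ℝ x y
  pos : ∀ x, x ≠ 0 → 0 < (riemannForm form).baseChange ℝ (X.J x) x

namespace Polarization
variable {X : Torus F M} (Θ : Polarization X)

theorem form_injective : Function.Injective Θ.form := by
  rw [← LinearMap.ker_eq_bot, LinearMap.ker_eq_bot']
  intro m hm
  by_contra h0
  have hz : ∀ y, (riemannForm Θ.form).baseChange ℝ y (1 ⊗ₜ[ℚ] m) = 0 := by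
    intro y
    induction y with
    | zero => simp
    | add x y hx hy => rw [map_add, LinearMap.add_apply, hx, hy, add_zero]
    | tmul r n =>
      have : Θ.form n m = 0 := by rw [← Θ.alt.neg, hm]; simp
      simp [LinearMap.BilinForm.baseChange_tmul, riemannForm, this]
  have h1 : (1 : ℝ) ⊗ₜ[ℚ] m ≠ 0 := fun h => h0 (by
    apply Module.FaithfullyFlat.tensorProduct_mk_injective (A := ℚ) (B := ℝ) M
    simpa using h)
  have := Θ.pos _ h1
  rw [hz] at this
  exact lt_irrefl _ this

/-- The `F`-linear isomorphism `H¹(X̂, ℚ) → H¹(X, ℚ)` of contraction with `Θ`. -/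
def contract : M ≃ₗ[F] Module.Dual F M :=
  have : Module.Finite F M := Module.Finite.of_restrictScalars_finite ℚ F M
  LinearEquiv.ofInjectiveOfFinrankEq Θ.form Θ.form_injective
    (Subspace.dual_finrank_eq (K := F) (V := M)).symm

theorem contract_apply (m : M) : Θ.contract m = Θ.form m := rfl

/-- The nilpotent map `(h, m) ↦ (-Θ⌟m, 0)`, that is `ρ_g - id` for `g` the wedge product with
`exp Θ`. -/
def nilp : V F M →ₗ[F] V F M :=
  -(LinearMap.inl F (Module.Dual F M) M ∘ₗ Θ.contract.toLinearMap ∘ₗ LinearMap.snd F _ _)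

end Polarization
end Torus

/-! ### The isotropic subspace `W` and the action `η` of `K` -/

section Eta
variable {F K M : Type*} [Field F] [NumberField F] [IsTotallyReal F] [Field K] [NumberField K]
  [IsTotallyComplex K] [Algebra F K] [Algebra.IsQuadraticExtension F K]
  [AddCommGroup M] [Module ℚ M] [Module F M] [Module.Finite ℚ M]
  {X : Torus F M} (Θ : Polarization X) (D : ImagGenerator F K)

/-- `ρ_{g₀} = id + (ρ_g - id) ⊗ √-q`. -/
def rhoG0 : K ⊗[F] V F M →ₗ[K] K ⊗[F] V F M :=
  LinearMap.id + D.r • Θ.nilp.baseChange K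

/-- `W = ρ_{g₀}(H¹(X̂, ℚ) ⊗_F K)`. -/
def W : Submodule K (K ⊗[F] V F M) :=
  ((LinearMap.range (LinearMap.inr F (Module.Dual F M) M)).baseChange K).map (rhoG0 Θ D)

variable (F K M) in
/-- `ι ⊗ id` on `K ⊗_F V`. -/
def conj : K ⊗[F] V F M →ₗ[F] K ⊗[F] V F M :=
  (iota F K).toLinearMap.rTensor (V F M)

theorem conj_tmul (k : K) (v : V F M) : conj F K M (k ⊗ₜ v) = iota F K k ⊗ₜ v := rfl

theorem conj_smul (k : K) (u : K ⊗[F] V F M) :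
    conj F K M (k • u) = iota F K k • conj F K M u := by
  induction u with
  | zero => simp
  | add x y hx hy => rw [smul_add, map_add, map_add, smul_add, hx, hy]
  | tmul a v => simp [TensorProduct.smul_tmul', conj_tmul]

theorem rhoG0_tmul (m : M) : rhoG0 Θ D (1 ⊗ₜ (0, m)) =
    (1 : K) ⊗ₜ ((0, m) : V F M) - D.r ⊗ₜ ((Θ.form m, 0) : V F M) := by
  simp only [rhoG0, Polarization.nilp, LinearMap.add_apply, LinearMap.id_apply,
    LinearMap.smul_apply, LinearMap.baseChange_tmul, LinearMap.neg_apply, LinearMap.comp_apply,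
    LinearMap.snd_apply, LinearEquiv.coe_coe, LinearMap.inl_apply, Polarization.contract_apply,
    TensorProduct.tmul_neg, smul_neg, TensorProduct.smul_tmul', smul_eq_mul, mul_one]
  rw [sub_eq_add_neg]

theorem W_induction {P : K ⊗[F] V F M → Prop} (h0 : P 0) (ha : ∀ x y, P x → P y → P (x + y))
    (hs : ∀ (k : K) x, P x → P (k • x))
    (ht : ∀ m : M, P ((1 : K) ⊗ₜ ((0, m) : V F M) - D.r ⊗ₜ ((Θ.form m, 0) : V F M))) :
    ∀ w ∈ W Θ D, P w := by
  rintro _ ⟨u, hu, rfl⟩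
  rw [SetLike.mem_coe, Submodule.baseChange_eq_span] at hu
  induction hu using Submodule.span_induction with
  | zero => simpa using h0
  | add x y _ _ hx hy => rw [map_add]; exact ha _ _ hx hy
  | mem x hx =>
    obtain ⟨v, ⟨m, rfl⟩, rfl⟩ := hx
    have := ht m
    rw [← rhoG0_tmul] at this
    exact this
  | smul k x _ hx => rw [map_smul]; exact hs _ _ hx

theorem mem_W (m : M) :
    (1 : K) ⊗ₜ ((0, m) : V F M) - D.r ⊗ₜ ((Θ.form m, 0) : V F M) ∈ W Θ D := by
  rw [← rhoG0_tmul]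
  exact ⟨_, Submodule.tmul_mem_baseChange_of_mem 1 ⟨m, rfl⟩, rfl⟩

/-- The square root of `-q` in `End_F(V)` underlying `η`. -/
def etaR : Module.End F (V F M) :=
  D.q • (LinearMap.inl F (Module.Dual F M) M ∘ₗ Θ.contract.toLinearMap ∘ₗ LinearMap.snd F _ _) -
    LinearMap.inr F (Module.Dual F M) M ∘ₗ Θ.contract.symm.toLinearMap ∘ₗ LinearMap.fst F _ _

theorem etaR_apply (v : V F M) :
    etaR Θ D v = (D.q • Θ.contract v.2, -Θ.contract.symm v.1) := by
  simp [etaR]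

theorem etaR_mul_etaR : etaR Θ D * etaR Θ D = -algebraMap F _ D.q := by
  ext v <;> simp [etaR_apply]

/-- There is exactly one `F`-algebra homomorphism `η : K → End_F(V)` for which `t` acts on `W` by
`t` and on the conjugate of `W` by `ι(t)`. -/
theorem existsUnique_eta : ∃! η : K →ₐ[F] Module.End F (V F M), ∀ t : K, ∀ w ∈ W Θ D,
    (η t).baseChange K w = t • w ∧
      (η t).baseChange K (conj F K M w) = iota F K t • conj F K M w := by
  refine ⟨D.lift (etaR Θ D) (etaR_mul_etaR Θ D), ?_, ?_⟩
  · intro t w hw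
    obtain ⟨a, b, rfl⟩ := D.exists_coords t
    have e : D.lift (etaR Θ D) (etaR_mul_etaR Θ D) (algebraMap F K a + algebraMap F K b * D.r) =
        algebraMap F _ a + b • etaR Θ D := by
      rw [map_add, map_mul, AlgHom.commutes, AlgHom.commutes, D.lift_r, Algebra.smul_def]
    have key : ∀ w ∈ W Θ D, (etaR Θ D).baseChange K w = D.r • w ∧
        (etaR Θ D).baseChange K (conj F K M w) = -(D.r • conj F K M w) := by
      refine W_induction Θ D (by simp) ?_ ?_ ?_
      · rintro x y ⟨h1, h2⟩ ⟨h3, h4⟩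
        constructor
        · rw [map_add, h1, h3, smul_add]
        · rw [map_add, map_add, h2, h4, smul_add, neg_add]
      · rintro k x ⟨h1, h2⟩
        constructor
        · rw [map_smul, h1, smul_comm]
        · rw [conj_smul, map_smul, h2, smul_neg, smul_comm]
      · intro m
        have h1 : D.r * D.r = -algebraMap F K D.q := by rw [← sq, D.sq]
        constructor
        · rw [map_sub, LinearMap.baseChange_tmul, LinearMap.baseChange_tmul, etaR_apply,
            etaR_apply, smul_sub, TensorProduct.smul_tmul', TensorProduct.smul_tmul']
          have h2 : ((D.q • Θ.contract m, -Θ.contract.symm 0) : V F M) =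
            D.q • (Θ.form m, (0 : M)) := by simp [Θ.contract_apply]
          have h3 : ((D.q • Θ.contract 0, -Θ.contract.symm (Θ.form m)) : V F M) =
            -(0, m) := by simp [← Θ.contract_apply]
          simp only [h2, h3, smul_eq_mul, mul_one, h1]
          rw [TensorProduct.tmul_smul, TensorProduct.smul_tmul', Algebra.smul_def,
            TensorProduct.tmul_neg, TensorProduct.neg_tmul, mul_one]
          abel
        · rw [map_sub, conj_tmul, conj_tmul, D.iota_r, map_one, TensorProduct.neg_tmul,
            sub_neg_eq_add, map_add, LinearMap.baseChange_tmul, LinearMap.baseChange_tmul,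
            etaR_apply, etaR_apply, smul_add, TensorProduct.smul_tmul',
            TensorProduct.smul_tmul']
          have h2 : ((D.q • Θ.contract m, -Θ.contract.symm 0) : V F M) =
            D.q • (Θ.form m, (0 : M)) := by simp [Θ.contract_apply]
          have h3 : ((D.q • Θ.contract 0, -Θ.contract.symm (Θ.form m)) : V F M) =
            -(0, m) := by simp [← Θ.contract_apply]
          simp only [h2, h3, smul_eq_mul, mul_one, h1]
          rw [TensorProduct.tmul_smul, TensorProduct.smul_tmul', Algebra.smul_def,
            TensorProduct.tmul_neg, TensorProduct.neg_tmul, mul_one]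
          abel
    obtain ⟨h1, h2⟩ := key w hw
    have h3 : ∀ u : K ⊗[F] V F M,
        ((algebraMap F (Module.End F (V F M)) a).baseChange K) u = algebraMap F K a • u := by
      intro u
      induction u with
      | zero => simp
      | add x y hx hy => rw [map_add, hx, hy, smul_add]
      | tmul k v =>
        simp [TensorProduct.smul_tmul', TensorProduct.tmul_smul, Algebra.smul_def]
    rw [e, LinearMap.baseChange_add, LinearMap.baseChange_smul, LinearMap.add_apply,
      LinearMap.add_apply, LinearMap.smul_apply, LinearMap.smul_apply, h1, h2, h3, h3]
    refine ⟨?_, ?_⟩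
    · rw [add_smul, mul_smul, algebraMap_smul, algebraMap_smul]
    · rw [map_add, map_mul, AlgEquiv.commutes, AlgEquiv.commutes, D.iota_r, add_smul, mul_smul,
        algebraMap_smul, algebraMap_smul, neg_smul]
  · intro η h
    refine D.algHom_ext' (R := Module.End F (V F M)) ?_
    rw [D.lift_r]
    have inj : ∀ x y : V F M, (1 : K) ⊗ₜ[F] x = 1 ⊗ₜ y → x = y := fun x y hxy =>
      Module.FaithfullyFlat.tensorProduct_mk_injective (A := F) (B := K) (V F M) (by simpa using hxy)
    have h1 : ∀ m, η D.r (0, m) = D.q • ((Θ.form m, 0) : V F M) := by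
      intro m
      obtain ⟨e1, e2⟩ := h D.r _ (mem_W Θ D m)
      rw [map_sub, conj_tmul, conj_tmul, D.iota_r, map_one, TensorProduct.neg_tmul,
            sub_neg_eq_add, map_add, LinearMap.baseChange_tmul, LinearMap.baseChange_tmul,
            smul_add, TensorProduct.smul_tmul', TensorProduct.smul_tmul', smul_eq_mul,
            smul_eq_mul, mul_one, neg_mul, ← sq, D.sq, neg_neg, TensorProduct.neg_tmul] at e2
      rw [map_sub, LinearMap.baseChange_tmul, LinearMap.baseChange_tmul,
            smul_sub, TensorProduct.smul_tmul', TensorProduct.smul_tmul', smul_eq_mul,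
            smul_eq_mul, mul_one, ← sq, D.sq, TensorProduct.neg_tmul, sub_neg_eq_add] at e1
      have e3 : (2 : F) • ((1 : K) ⊗ₜ[F] (η D.r (0, m))) =
          (2 : F) • (algebraMap F K D.q ⊗ₜ[F] ((Θ.form m, 0) : V F M)) := by
        rw [two_smul, two_smul]
        have e5 := congrArg₂ (· + ·) e1 e2
        rw [show ∀ A B : K ⊗[F] V F M, A + A = (A - B) + (A + B) from fun A B => by abel]
        refine e5.trans ?_
        abel
      have e4 := smul_right_injective _ (two_ne_zero (α := F)) e3
      apply inj
      rw [e4, TensorProduct.tmul_smul, TensorProduct.smul_tmul', Algebra.smul_def, mul_one]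
    have hq : D.q ≠ 0 := by
      intro hq
      have := D.sq
      rw [hq, map_zero, neg_zero] at this
      exact D.r_notMem 0 (by rw [map_zero]; exact (pow_eq_zero_iff two_ne_zero |>.mp this).symm)
    have h2 : ∀ n, η D.r (Θ.form n, 0) = -((0, n) : V F M) := by
      intro n
      have e1 : η D.r (η D.r (0, n)) = -(D.q • (0, n)) := by
        rw [← Module.End.mul_apply, ← map_mul, ← sq, D.sq, map_neg, AlgHom.commutes,
          LinearMap.neg_apply, Module.algebraMap_end_apply]
      rw [h1, map_smul, ← smul_neg (A := V F M)] at e1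
      exact smul_right_injective _ hq e1
    refine LinearMap.ext fun v => ?_
    obtain ⟨f, m⟩ := v
    have h3 := h2 (Θ.contract.symm f)
    rw [← Θ.contract_apply, LinearEquiv.apply_symm_apply] at h3
    have : ((f, m) : V F M) = (f, 0) + (0, m) := by simp
    rw [this, map_add, h1, h3, etaR_apply]
    simp [Θ.contract_apply]

/-- The action `η : K → End(V)`. -/
def eta : K →ₐ[F] Module.End F (V F M) := (existsUnique_eta Θ D).choose

theorem eta_spec (t : K) (w : K ⊗[F] V F M) (hw : w ∈ W Θ D) :
    (eta Θ D t).baseChange K w = t • w ∧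
      (eta Θ D t).baseChange K (conj F K M w) = iota F K t • conj F K M w :=
  (existsUnique_eta Θ D).choose_spec.1 t w hw

end Eta

/-! ### The complex structure of `X × X̂` -/

section ComplexStructure
variable {F M : Type*} [Field F] [NumberField F] [AddCommGroup M] [Module ℚ M] [Module F M]
  [Module.Finite ℚ M]

/-- The complex structure on `H¹(X, ℝ)`: the transpose of `J`. -/
def Torus.cohJ (X : Torus F M) : Module.End ℝ (ℝ ⊗[ℚ] Module.Dual F M) :=
  (realDual F M).symm.conj (X.J.dualMap : Module.End ℝ (Module.Dual ℝ (ℝ ⊗[ℚ] M)))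

/-- The complex structure of `X × X̂`, acting on `H¹(X × X̂, ℝ) = H¹(X, ℝ) ⊕ H₁(X, ℝ)`. The dual
torus has `H₁(X̂, ℝ) = H¹(X, ℝ)` with complex structure `-Jᵗ`. -/
def Torus.prodDualJ (X : Torus F M) : Module.End ℝ (VA F M ℝ) :=
  (TensorProduct.prodRight ℚ ℝ ℝ (Module.Dual F M) M).symm.conj
    (LinearMap.prodMap X.cohJ (-X.J))

end ComplexStructure

/-! ### The secant space `B` and the period domain -/

section Period
variable {F K M : Type*} [Field F] [NumberField F] [IsTotallyReal F] [Field K] [NumberField K]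
  [IsTotallyComplex K] [Algebra F K] [Algebra.IsQuadraticExtension F K]
  [AddCommGroup M] [Module ℚ M] [Module F M] [Module.Finite ℚ M]
  {X : Torus F M} (Θ : Polarization X) (D : ImagGenerator F K)

/-- The action of `η(t)` on `V_A`. -/
def etaA (A : Type*) [Field A] [Algebra ℚ A] (t : K) : Module.End A (VA F M A) :=
  ((eta Θ D t).restrictScalars ℚ).baseChange A

/-- The eigenspace `V_{σ,ℂ}` of the character `σ` of `K`. -/
def Vsigma (σ : K →+* ℂ) : Submodule ℂ (VA F M ℂ) :=
  ⨅ t : K, Module.End.eigenspace (etaA Θ D ℂ t) (σ t)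

variable (F K) in
/-- A CM-type: the choice of an extension to `K` of each embedding of `F`. -/
structure CMType where
  toFun : (F →+* ℝ) → (K →+* ℂ)
  extends_self : ∀ τ a, toFun τ (algebraMap F K a) = (τ a : ℂ)

/-- `W_T = ⨁_τ V_{T(τ),ℂ}`. -/
def WT (T : CMType F K) : Submodule ℂ (VA F M ℂ) := ⨆ τ, Vsigma Θ D (T.toFun τ)

/-- The line of pure spinors annihilated by `W_T`. -/
def ellT (T : CMType F K) : Submodule ℂ (ℂ ⊗[ℚ] S F M) :=
  ⨅ w ∈ WT Θ D T, LinearMap.ker (spinRepA F M ℂ (CliffordAlgebra.ι (QA F M ℂ) w))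

/-- The secant space `B`: the rational subspace of `S` with `B ⊗ ℂ = ∑_T ℓ_T`. -/
def B : Submodule ℚ (S F M) :=
  ((⨆ T : CMType F K, ellT Θ D T).restrictScalars ℚ).comap (TensorProduct.mk ℚ ℂ (S F M) 1)

/-- The image `ρ(Spin(V_ℝ)_B)` of the pointwise stabilizer of `B` in `Spin(V_ℝ)`, where
`ρ_g(v) = g v g⁻¹`. -/
def rhoSpinB : Set (Module.End ℝ (VA F M ℝ)) :=
  {f | ∃ g ∈ spinGroup (QA F M ℝ),
    (∀ b ∈ B Θ D, spinRepA F M ℝ g (1 ⊗ₜ[ℚ] b) = 1 ⊗ₜ[ℚ] b) ∧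
    ∀ v, CliffordAlgebra.ι (QA F M ℝ) (f v) = g * CliffordAlgebra.ι (QA F M ℝ) v * star g}

variable (F M) in
/-- The rational pairing `(x, y)_V = tr_{F/ℚ} (x, y)_{V_η̂}`. -/
def Qpair : LinearMap.BilinForm ℚ (V F M) := QuadraticMap.polarBilin (Q F M)

/-- `Ξ_t(x, y) = (η_t x, y)_V`, extended to `V_ℝ`. -/
def Xi (t : K) : LinearMap.BilinForm ℝ (VA F M ℝ) :=
  ((Qpair F M).baseChange ℝ).compLeft (etaA Θ D ℝ t)

/-- For every embedding `σ` of `K`, both eigenspaces of `I` in `V_{σ,ℂ}` (those for `i` and `-i`)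
have dimension `d / 2`, where `d = dim_F H¹(X, ℚ)`. -/
def HasWeilSignature (I : Module.End ℝ (VA F M ℝ)) : Prop :=
  ∀ σ : K →+* ℂ,
    2 * Module.finrank ℂ ↥(Vsigma Θ D σ ⊓ (complexify I).eigenspace Complex.I) =
      Module.finrank F (Module.Dual F M) ∧
    2 * Module.finrank ℂ ↥(Vsigma Θ D σ ⊓ (complexify I).eigenspace (-Complex.I)) =
      Module.finrank F (Module.Dual F M)

/-- The period domain `Ω_{B,t}`. -/
def Omega (t : K) : Set (Module.End ℝ (VA F M ℝ)) :=
  {I | I ∈ rhoSpinB Θ D ∧ I * I = -1 ∧ HasWeilSignature Θ D I ∧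
    (∀ x y, Xi Θ D t x (I y) = Xi Θ D t y (I x)) ∧ ∀ x, x ≠ 0 → 0 < Xi Θ D t x (I x)}

/-- `(I, η, Ξ_t)` is a polarized abelian variety of Weil type: `η(K)` acts by Hodge endomorphisms,
the eigenspaces have the required dimensions, and `Ξ_t` is a polarization for which the adjoint of
`η_s` is `η_{ι(s)}`. -/
structure IsPolarizedWeilType (I : Module.End ℝ (VA F M ℝ)) (t : K) : Prop where
  sq : I * I = -1
  commute : ∀ s : K, Commute I (etaA Θ D ℝ s)
  signature : HasWeilSignature Θ D I
  alt : (Xi Θ D t).IsAlt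
  adjoint : ∀ (s : K) (x y : VA F M ℝ),
    Xi Θ D t (etaA Θ D ℝ s x) y = Xi Θ D t x (etaA Θ D ℝ (iota F K s) y)
  invariant : ∀ x y, Xi Θ D t (I x) (I y) = Xi Θ D t x y
  pos : ∀ x, x ≠ 0 → 0 < Xi Θ D t x (I x)

end Period

/-! ### The hermitian form and split type -/

section Hermitian
variable {F K M : Type*} [Field F] [NumberField F] [IsTotallyReal F] [Field K] [NumberField K]
  [IsTotallyComplex K] [Algebra F K] [Algebra.IsQuadraticExtension F K]
  [AddCommGroup M] [Module ℚ M] [Module F M] [Module.Finite ℚ M]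
  {X : Torus F M}

/-- `V_ℚ` as a `K`-vector space through `η`. -/
def Veta (_ : Polarization X) (_ : ImagGenerator F K) : Type _ := V F M

variable (Θ : Polarization X) (D : ImagGenerator F K)

instance : AddCommGroup (Veta Θ D) := inferInstanceAs (AddCommGroup (V F M))

instance : Module K (Veta Θ D) :=
  Module.compHom (V F M) (eta Θ D : K →+* Module.End F (V F M))

/-- `H_t(x, y) = (-t²) (x, y)_{V_η̂} + t (η_t x, y)_{V_η̂}`. -/
def hermForm (t : K) (x y : Veta Θ D) : K :=
  -t ^ 2 * algebraMap F K (Fpair F M x y) +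
    t * algebraMap F K (Fpair F M (eta Θ D t x) y)

/-- A hermitian form `h` on the `K`-vector space `V_η` is of split type: it has an isotropic
subspace of half the dimension and, in terms of invariants, for some orthogonal basis its diagonal
coefficients in `Fˣ` have as many positive as negative images under each embedding of `F` in `ℝ`,
and its discriminant is the class of `(-1)^{d/2}` modulo norms from `Kˣ`. -/
structure IsSplit (h : Veta Θ D → Veta Θ D → K) : Prop where
  isotropic : ∃ U : Submodule K (Veta Θ D),
    2 * Module.finrank K U = Module.finrank K (Veta Θ D) ∧ ∀ x ∈ U, ∀ y ∈ U, h x y = 0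
  invariants : ∃ (n : ℕ) (b : Module.Basis (Fin n) K (Veta Θ D)) (c : Fin n → F),
    (∀ i j, i ≠ j → h (b i) (b j) = 0) ∧
    (∀ i, c i ≠ 0 ∧ h (b i) (b i) = algebraMap F K (c i)) ∧
    (∀ τ : F →+* ℝ, Nat.card {i // 0 < τ (c i)} = Nat.card {i // τ (c i) < 0}) ∧
    ∃ z : K, z ≠ 0 ∧ ∏ i, c i = (-1) ^ (n / 2) * Algebra.norm F z

end Hermitian
end WeilType
end

/-! Take `t = √-q`. Contraction with `Θ` identifies `H¹(X)` with `H₁(X)`, so `V` becomes two copies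
of `H₁(X)`, the coordinates `(n, m)` standing for `(Θ(n, ·), m)`. Put `ψ = tr ∘ Θ`. In these
coordinates `η_t` is `(n, m) ↦ (q m, -n)` and the pairing is `ψ(n, m') + ψ(n', m)`. The transpose of
`J` sends `Θ(n, ·)` to `-Θ(Jn, ·)`, so the complex structure `I` of `X × X̂` is `-J` on both copies.
Hence `I` commutes with `η`, and `Ξ_t` is the orthogonal sum of `ψ` and of its twist `ψ(q ·, ·)`.
Positivity is inherited from the polarization, because `q` is totally positive (`embedding_q_pos`)
and the real eigenspaces of `F` are mutually orthogonal (`psi_J_q_pos`).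

For `I ∈ ρ(Spin(V_ℝ)_B)`: every `f ∈ GL(N)` acts on `N^* ⊕ N` through an even Clifford element of
norm `det f` that multiplies the degree-zero component of spinors by `det f`
(`PolarizedRep.hasLift`). Since `det(-J) = 1` (`det_neg_J`), the lift of `-J` lies in the spin group
and preserves that component. It maps each `ℓ_T` to itself because `I` preserves `W_T`. As `W_T`
surjects onto `H₁(X, ℂ)`, a spinor in `ℓ_T` is determined by its degree-zero component
(`eq_zero_of_vac_eq_zero`). So the lift is the identity on every `ℓ_T`, hence on `B` (`fixes_B`).

For the signature: `V_{σ,ℂ}` has dimension `d`, and `(h, m) ↦ (-h, m)` exchanges `W` and its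
conjugate. Its antilinear extension therefore preserves `V_{σ,ℂ}`, commutes with `I`, and swaps the
eigenvalues `i` and `-i`.

For the split type: on `H₁(X, ℚ)` the hermitian form is `t q Θ`, so a symplectic `F`-basis for `Θ`
cuts `V` into hyperbolic planes, each diagonalized as `⟨2, -2⟩` (`isSplit`). -/

set_option linter.unusedSectionVars false

noncomputable section

namespace WeilType

/-! ### Lifting `GL(N)` to the Clifford algebra of `N^* ⊕ N` -/

section SpinLift
variable {k N U S : Type*} [Field k] [AddCommGroup N] [Module k N] [AddCommGroup U]
  [Module k U] [AddCommGroup S] [Module k S]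

/-- A pair of complementary isotropic maps `N^* → U`, `N → U`, together with a representation of the
Clifford algebra and a linear form on it that vanishes on the image of `N^*`. -/
structure PolarizedRep (N S : Type*) [AddCommGroup N] [Module k N] [AddCommGroup S] [Module k S]
    (q : QuadraticForm k U) where
  inl : Module.Dual k N →ₗ[k] U
  inr : N →ₗ[k] U
  inl_isotropic : ∀ h, q (inl h) = 0
  inr_isotropic : ∀ m, q (inr m) = 0
  polar_inl_inr : ∀ h m, QuadraticMap.polar q (inl h) (inr m) = h m
  rep : CliffordAlgebra q →ₐ[k] Module.End k S
  vac : S →ₗ[k] k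
  vac_inl : ∀ h s, vac (rep (CliffordAlgebra.ι q (inl h)) s) = 0

namespace PolarizedRep
variable {q : QuadraticForm k U} (P : PolarizedRep N S q)

/-- The Clifford element of a linear form on `N`. -/
def X : Module.Dual k N →ₗ[k] CliffordAlgebra q := CliffordAlgebra.ι q ∘ₗ P.inl

/-- The Clifford element of a vector of `N`. -/
def E : N →ₗ[k] CliffordAlgebra q := CliffordAlgebra.ι q ∘ₗ P.inr

theorem X_mul_X_self (h : Module.Dual k N) : P.X h * P.X h = 0 := by
  simp [X, CliffordAlgebra.ι_sq_scalar, P.inl_isotropic]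

theorem E_mul_E_self (m : N) : P.E m * P.E m = 0 := by
  simp [E, CliffordAlgebra.ι_sq_scalar, P.inr_isotropic]

theorem X_mul_X (h h' : Module.Dual k N) : P.X h * P.X h' = -(P.X h' * P.X h) := by
  have := P.X_mul_X_self (h + h')
  simp only [map_add, add_mul, mul_add, X_mul_X_self, zero_add, add_zero] at this
  exact eq_neg_of_add_eq_zero_right this

theorem E_mul_E (m m' : N) : P.E m * P.E m' = -(P.E m' * P.E m) := by
  have := P.E_mul_E_self (m + m')
  simp only [map_add, add_mul, mul_add, E_mul_E_self, zero_add, add_zero] at this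
  exact eq_neg_of_add_eq_zero_right this

theorem X_mul_E (h : Module.Dual k N) (m : N) :
    P.X h * P.E m = algebraMap k _ (h m) - P.E m * P.X h := by
  rw [eq_sub_iff_add_eq]
  simp only [X, E, LinearMap.comp_apply]
  rw [CliffordAlgebra.ι_mul_ι_add_swap, P.polar_inl_inr]

theorem E_mul_X (h : Module.Dual k N) (m : N) :
    P.E m * P.X h = algebraMap k _ (h m) - P.X h * P.E m := by
  rw [X_mul_E]; abel

theorem star_X (h : Module.Dual k N) : star (P.X h) = -P.X h := by
  simp [X, CliffordAlgebra.star_ι]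

theorem star_E (m : N) : star (P.E m) = -P.E m := by
  simp [E, CliffordAlgebra.star_ι]

theorem E_mul_X_mem_even (h : Module.Dual k N) (m : N) :
    P.E m * P.X h ∈ CliffordAlgebra.even q :=
  CliffordAlgebra.ι_mul_ι_mem_evenOdd_zero q _ _

/-- `f ∈ End(N)` is induced by an even element of the Lipschitz group of spinor norm `det f` which
scales the linear form `vac` by `det f`. -/
def HasLift (f : Module.End k N) : Prop :=
  ∃ g : (CliffordAlgebra q)ˣ, g ∈ lipschitzGroup q ∧ (g : CliffordAlgebra q) ∈ CliffordAlgebra.even q ∧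
    star (g : CliffordAlgebra q) * g = algebraMap k _ (LinearMap.det f) ∧
    (g : CliffordAlgebra q) * star (g : CliffordAlgebra q) = algebraMap k _ (LinearMap.det f) ∧
    (∀ m, g * P.E m = P.E (f m) * g) ∧ (∀ h : Module.Dual k N, g * P.X (h ∘ₗ f) = P.X h * g) ∧
    ∀ s, P.vac (P.rep g s) = LinearMap.det f * P.vac s

variable {P}

theorem HasLift.one : P.HasLift 1 :=
  ⟨1, one_mem _, by simp, by simp, by simp, by simp,
    fun h => by simp [Module.End.one_eq_id], by simp⟩

/-- Spinor norm and scaling of `vac` are scalars, hence multiplicative. This reduces the lifting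
problem to generators of `GL(N)`. -/
theorem HasLift.mul {f₁ f₂ : Module.End k N} (h₁ : P.HasLift f₁) (h₂ : P.HasLift f₂) :
    P.HasLift (f₁ * f₂) := by
  obtain ⟨g₁, l₁, e₁, s₁, t₁, m₁, d₁, v₁⟩ := h₁
  obtain ⟨g₂, l₂, e₂, s₂, t₂, m₂, d₂, v₂⟩ := h₂
  refine ⟨g₁ * g₂, mul_mem l₁ l₂, by simpa using mul_mem e₁ e₂, ?_, ?_, ?_, ?_, ?_⟩
  · rw [Units.val_mul, star_mul, mul_assoc, ← mul_assoc (star _) _ (g₂ : CliffordAlgebra q), s₁,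
      Algebra.commutes, ← mul_assoc, s₂, ← map_mul, map_mul, ← map_mul, mul_comm,
      map_mul LinearMap.det]
  · rw [Units.val_mul, star_mul, mul_assoc, ← mul_assoc (g₂ : CliffordAlgebra q), t₂,
      Algebra.commutes, ← mul_assoc, t₁, map_mul, map_mul]
  · intro m
    rw [Units.val_mul, mul_assoc, m₂, ← mul_assoc, m₁, mul_assoc, Module.End.mul_apply]
  · intro h
    rw [Units.val_mul, mul_assoc, Module.End.mul_eq_comp, ← LinearMap.comp_assoc, d₂, ← mul_assoc,
      d₁, mul_assoc]
  · intro s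
    rw [Units.val_mul, map_mul, Module.End.mul_apply, v₁, v₂, map_mul, mul_assoc]

variable (P)

/-- `1 + e x`, for `x` a linear form and `e` a vector. -/
def rankOneElt (φ : Module.Dual k N) (n : N) : CliffordAlgebra q := 1 + P.E n * P.X φ

/-- Moving `E m` past `E n * X φ` costs `φ m • E n`. The second-order term on the right disappears
because `E n` squares to zero, so the identity needs no invertibility. -/
theorem rankOneElt_mul_E (φ : Module.Dual k N) (n m : N) :
    P.rankOneElt φ n * P.E m = P.E (m + φ m • n) * P.rankOneElt φ n := by
  have h1 : P.E n * P.X φ * P.E m = algebraMap k _ (φ m) * P.E n + P.E m * (P.E n * P.X φ) := by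
    rw [mul_assoc, X_mul_E, mul_sub, ← Algebra.commutes, ← mul_assoc, E_mul_E P n m, neg_mul,
      sub_neg_eq_add, mul_assoc]
  have h2 : P.E n * (P.E n * P.X φ) = 0 := by rw [← mul_assoc, E_mul_E_self, zero_mul]
  rw [rankOneElt, map_add, map_smul, add_mul, mul_add, add_mul, mul_one, one_mul, h1,
    mul_one, add_mul, smul_mul_assoc, h2, smul_zero, add_zero, Algebra.smul_def]
  abel

/-- Dual computation, now with `X φ` squaring to zero; `h + h n • φ` is the pullback of `h` along `m
↦ m + φ m • n`. -/
theorem rankOneElt_mul_X (φ : Module.Dual k N) (n : N) (h : Module.Dual k N) :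
    P.rankOneElt φ n * P.X (h + h n • φ) = P.X h * P.rankOneElt φ n := by
  have h1 : P.X h * (P.E n * P.X φ) = algebraMap k _ (h n) * P.X φ + P.E n * P.X φ * P.X h := by
    rw [← mul_assoc, X_mul_E, sub_mul, mul_assoc, X_mul_X P h φ, mul_neg, sub_neg_eq_add, mul_assoc]
  have h2 : P.E n * P.X φ * P.X φ = 0 := by rw [mul_assoc, X_mul_X_self, mul_zero]
  rw [rankOneElt, map_add, map_smul, mul_add, add_mul, mul_add, mul_one, one_mul, h1,
    mul_smul_comm, add_mul, one_mul, h2, add_zero, Algebra.smul_def]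
  abel

theorem star_rankOneElt (φ : Module.Dual k N) (n : N) :
    star (P.rankOneElt φ n) = 1 + P.X φ * P.E n := by
  simp [rankOneElt, star_X, star_E]

/-- The scalar is the determinant of `m ↦ m + φ m • n`. -/
theorem star_rankOneElt_mul (φ : Module.Dual k N) (n : N) :
    star (P.rankOneElt φ n) * P.rankOneElt φ n = algebraMap k _ (1 + φ n) := by
  have h1 : P.X φ * P.E n * (P.E n * P.X φ) = 0 := by
    rw [mul_assoc, ← mul_assoc (P.E n), E_mul_E_self, zero_mul, mul_zero]
  rw [star_rankOneElt, rankOneElt, add_mul, mul_add, mul_add, h1, X_mul_E, map_add, map_one]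
  noncomm_ring

theorem rankOneElt_mul_star (φ : Module.Dual k N) (n : N) :
    P.rankOneElt φ n * star (P.rankOneElt φ n) = algebraMap k _ (1 + φ n) := by
  have h1 : P.E n * P.X φ * (P.X φ * P.E n) = 0 := by
    rw [mul_assoc, ← mul_assoc (P.X φ), X_mul_X_self, zero_mul, mul_zero]
  rw [star_rankOneElt, rankOneElt, add_mul, mul_add, mul_add, h1, X_mul_E, map_add, map_one]
  noncomm_ring

/-- Reordering `E n * X φ` as `φ n - X φ * E n` puts a wedge factor on the left, which `vac`
annihilates. -/
theorem vac_rankOneElt (φ : Module.Dual k N) (n : N) (s : S) :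
    P.vac (P.rep (P.rankOneElt φ n) s) = (1 + φ n) * P.vac s := by
  have : P.vac (P.rep (P.X φ * P.E n) s) = 0 := by
    rw [map_mul]; exact P.vac_inl φ _
  rw [rankOneElt, E_mul_X, map_add, map_sub, map_one, LinearMap.add_apply, LinearMap.sub_apply,
    map_add, map_sub, this, AlgHom.commutes]
  simp; ring

theorem ι_mem_lipschitz (u : U) (hu : q u ≠ 0) :
    ∃ g ∈ lipschitzGroup q, (g : CliffordAlgebra q) = CliffordAlgebra.ι q u := by
  have := invertibleOfNonzero hu
  have := CliffordAlgebra.invertibleιOfInvertible q u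
  exact ⟨unitOfInvertible (CliffordAlgebra.ι q u), Subgroup.subset_closure ⟨u, rfl⟩, rfl⟩

theorem q_combination (φ : Module.Dual k N) (n : N) (x y : k) :
    q (x • P.inl φ + y • P.inr n) = x * y * φ n := by
  rw [QuadraticMap.map_add q, QuadraticMap.map_smul, QuadraticMap.map_smul, P.inl_isotropic,
    P.inr_isotropic, QuadraticMap.polar_smul_left, QuadraticMap.polar_smul_right, P.polar_inl_inr]
  simp; ring

/-- In the hyperbolic plane of `φ` and `n` the element is a product of two anisotropic vectors. The
two coefficients of `φ` are chosen so that the vectors have `q`-values `1` and `1 + φ n` and the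
product has constant term `1`. -/
theorem rankOneElt_mem_lipschitz_aux (φ : Module.Dual k N) (n : N) (h0 : φ n ≠ 0)
    (h1 : 1 + φ n ≠ 0) :
    ∃ g ∈ lipschitzGroup q, (g : CliffordAlgebra q) = P.rankOneElt φ n := by
  obtain ⟨g, hg, hg'⟩ := ι_mem_lipschitz (q := q) ((φ n)⁻¹ • P.inl φ + (1 : k) • P.inr n)
    (by rw [P.q_combination]; simpa using h0)
  obtain ⟨g', hg₁, hg₁'⟩ := ι_mem_lipschitz (q := q)
    ((1 + (φ n)⁻¹) • P.inl φ + (1 : k) • P.inr n)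
    (by rw [P.q_combination]; rw [mul_one, add_mul, inv_mul_cancel₀ h0, one_mul, add_comm]; exact h1)
  refine ⟨g * g', mul_mem hg hg₁, ?_⟩
  rw [Units.val_mul, hg', hg₁']
  have e1 : ∀ h, CliffordAlgebra.ι q (P.inl h) = P.X h := fun _ => rfl
  have e2 : ∀ h, CliffordAlgebra.ι q (P.inr h) = P.E h := fun _ => rfl
  simp only [map_add, map_smul, e1, e2, add_mul, mul_add, smul_mul_assoc, mul_smul_comm,
    X_mul_X_self, E_mul_E_self, X_mul_E, rankOneElt, Algebra.algebraMap_eq_smul_one, smul_sub,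
    smul_smul]
  rw [inv_mul_cancel₀ h0]
  module

theorem rankOneElt_mul_rankOneElt (φ ψ : Module.Dual k N) (n : N) :
    P.rankOneElt φ n * P.rankOneElt ψ n = P.rankOneElt (φ + (1 + φ n) • ψ) n := by
  have : P.E n * P.X φ * (P.E n * P.X ψ) = φ n • (P.E n * P.X ψ) := by
    rw [mul_assoc, ← mul_assoc (P.X φ), X_mul_E, sub_mul, mul_sub, mul_assoc (P.E n), ← mul_assoc (P.E n) (P.E n),
      E_mul_E_self, zero_mul, sub_zero, ← mul_assoc, ← Algebra.commutes, mul_assoc, Algebra.smul_def]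
  simp only [rankOneElt, add_mul, mul_add, one_mul, mul_one, this, map_add, map_smul, add_smul,
    one_smul, mul_smul_comm]
  abel

theorem rankOneElt_mem_lipschitz [NeZero (2 : k)] (φ : Module.Dual k N) (n : N) (h1 : 1 + φ n ≠ 0) :
    ∃ g ∈ lipschitzGroup q, (g : CliffordAlgebra q) = P.rankOneElt φ n := by
  have two : (2 : k) ≠ 0 := NeZero.ne _
  by_cases hn : n = 0
  · exact ⟨1, one_mem _, by simp [rankOneElt, hn]⟩
  by_cases h0 : φ n = 0
  -- A transvection is not covered by the previous lemma, so it is split by the composition law.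
  -- With `χ n = 1` the factors come from `χ` and `(φ - χ)/2`, since `χ + (1 + χ n)(φ - χ)/2 = φ`.
  -- Their values at `n` are `1` and `-1/2`, so both are covered.
  · obtain ⟨ψ, hψ⟩ := Module.Projective.exists_dual_ne_zero k hn
    set χ : Module.Dual k N := (ψ n)⁻¹ • ψ with hχ
    have hχn : χ n = 1 := by simp [hχ, hψ]
    have e1 : ((2 : k)⁻¹ • (φ - χ)) n = -(2 : k)⁻¹ := by simp [h0, hχn]
    obtain ⟨g, hg, hg'⟩ := P.rankOneElt_mem_lipschitz_aux χ n (by simp [hχn])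
      (by rw [hχn, one_add_one_eq_two]; exact two)
    obtain ⟨g', hg₁, hg₁'⟩ := P.rankOneElt_mem_lipschitz_aux ((2 : k)⁻¹ • (φ - χ)) n
      (by rw [e1]; simpa using two) (by
        rw [e1]
        have : (1 : k) + -2⁻¹ = 2⁻¹ := by field_simp; norm_num
        rw [this]; simpa using two)
    refine ⟨g * g', mul_mem hg hg₁, ?_⟩
    rw [Units.val_mul, hg', hg₁', rankOneElt_mul_rankOneElt, hχn, one_add_one_eq_two,
      smul_smul, mul_inv_cancel₀ two, one_smul]
    congr 1; abel
  · exact P.rankOneElt_mem_lipschitz_aux φ n h0 h1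

theorem hasLift_rankOne [NeZero (2 : k)] (φ : Module.Dual k N) (n : N) (f : Module.End k N)
    (hf : ∀ m, f m = m + φ m • n) (hdet : LinearMap.det f = 1 + φ n) (h1 : 1 + φ n ≠ 0) :
    P.HasLift f := by
  obtain ⟨g, hg, hg'⟩ := P.rankOneElt_mem_lipschitz φ n h1
  refine ⟨g, hg, ?_, ?_, ?_, ?_, ?_, ?_⟩
  · rw [hg']; exact add_mem (one_mem _) (P.E_mul_X_mem_even φ n)
  · rw [hg', star_rankOneElt_mul, hdet]
  · rw [hg', rankOneElt_mul_star, hdet]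
  · intro m; rw [hg', hf, rankOneElt_mul_E]
  · intro h
    rw [hg', ← rankOneElt_mul_X]
    congr 2
    ext m
    simp [hf, mul_comm]
  · intro s; rw [hg', vac_rankOneElt, hdet]

-- Invertible matrices are generated by transvections and invertible diagonal matrices, and both
-- types reduce to maps `m ↦ m + φ m • n`.
open Matrix in
theorem hasLift_toLin [NeZero (2 : k)] {n : Type*} [Fintype n] [DecidableEq n]
    (b : Module.Basis n k N) (A : Matrix n n k) (hA : A.det ≠ 0) :
    P.HasLift (Matrix.toLin b b A) := by
  refine Matrix.diagonal_transvection_induction_of_det_ne_zero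
    (fun A => P.HasLift (Matrix.toLin b b A)) A hA ?_ ?_ ?_
  · intro D hD
    rw [det_diagonal, Finset.prod_ne_zero_iff] at hD
    -- A diagonal matrix is built one entry at a time. The factor changing only the entry `j` is the
    -- rank-one perturbation with `φ = (D j - 1) • b.coord j` and vector `b j`.
    have key : ∀ s : Finset n, P.HasLift (toLin b b (diagonal fun i => if i ∈ s then D i else 1)) := by
      intro s
      induction s using Finset.induction_on with
      | empty => simpa [Module.End.one_eq_id] using HasLift.one (P := P)
      | insert j s hj ih =>
        have e : (diagonal fun i => if i ∈ insert j s then D i else 1) =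
            (diagonal fun i => if i = j then D i else 1) *
              diagonal fun i => if i ∈ s then D i else 1 := by
          rw [diagonal_mul_diagonal]
          congr 1; ext i
          by_cases hij : i = j <;> simp [hij, hj]
        rw [e, toLin_mul b b b]
        refine HasLift.mul (P.hasLift_rankOne ((D j - 1) • b.coord j) (b j) _ ?_ ?_ ?_) ih
        · intro m
          have : toLin b b (diagonal fun i => if i = j then D i else 1) =
              LinearMap.id + ((D j - 1) • b.coord j).smulRight (b j) := by
            refine b.ext fun i => ?_
            rw [toLin_self, Finset.sum_eq_single i (fun l _ hl => by simp [hl]) (by simp)]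
            by_cases hij : i = j
            · subst hij; simp [sub_smul]
            · simp [hij]
          rw [this]; rfl
        · rw [LinearMap.det_toLin, det_diagonal]; simp
        · simpa using hD j (Finset.mem_univ _)
    simpa using key Finset.univ
  · intro t
    refine P.hasLift_rankOne (t.c • b.coord t.j) (b t.i) _ ?_ ?_ ?_
    · intro m
      have : toLin b b t.toMatrix = LinearMap.id + (t.c • b.coord t.j).smulRight (b t.i) := by
        refine b.ext fun i => ?_
        simp only [toLin_self, TransvectionStruct.toMatrix, transvection, Matrix.add_apply, add_smul,
          Finset.sum_add_distrib, one_apply, single_apply]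
        simp [ite_and, Finsupp.single_apply, eq_comm]
      rw [this]; rfl
    · rw [LinearMap.det_toLin]; simp [t.hij]
    · simp [t.hij]
  · intro A B _ _ hA hB
    rw [toLin_mul b b b]
    exact hA.mul hB

theorem hasLift [NeZero (2 : k)] [Module.Finite k N] (f : Module.End k N)
    (hf : LinearMap.det f ≠ 0) : P.HasLift f := by
  have := P.hasLift_toLin (Module.finBasis k N)
    (LinearMap.toMatrix (Module.finBasis k N) (Module.finBasis k N) f)
    (by rwa [LinearMap.det_toMatrix])
  rwa [Matrix.toLin_toMatrix] at this

end PolarizedRep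
end SpinLift

/-! ### The spin representation over a field extension -/

section SpinRep
variable (F M : Type*) [Field F] [NumberField F] [AddCommGroup M] [Module ℚ M] [Module F M]
  [Module.Finite ℚ M] (A : Type*) [Field A] [Algebra ℚ A]

/-- The inclusion of `H¹(X, A)` in `V_A`. -/
def inH : A ⊗[ℚ] Module.Dual F M →ₗ[A] VA F M A :=
  (LinearMap.inl ℚ (Module.Dual F M) M).baseChange A

/-- The inclusion of `H₁(X, A)` in `V_A`. -/
def inM : A ⊗[ℚ] M →ₗ[A] VA F M A := (LinearMap.inr ℚ (Module.Dual F M) M).baseChange A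

/-- The pairing on `V_A`. -/
abbrev pairA : LinearMap.BilinForm A (VA F M A) := (Qpair F M).baseChange A

/-- The Clifford multiplication of `V_A` on `A ⊗ S`. -/
def cl : VA F M A →ₗ[A] Module.End A (A ⊗[ℚ] S F M) :=
  (spinRepA F M A).toLinearMap ∘ₗ CliffordAlgebra.ι (QA F M A)

/-- The component of degree zero of a spinor. -/
def vac : A ⊗[ℚ] S F M →ₗ[A] A :=
  (TensorProduct.AlgebraTensorModule.rid ℚ A A).toLinearMap ∘ₗ
    (ExteriorAlgebra.algebraMapInv (R := ℚ) (M := Module.Dual F M)).toLinearMap.baseChange A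

variable {F M A}

@[simp] theorem inH_tmul (a : A) (h : Module.Dual F M) : inH F M A (a ⊗ₜ h) = a ⊗ₜ (h, 0) := rfl
@[simp] theorem inM_tmul (a : A) (m : M) : inM F M A (a ⊗ₜ m) = a ⊗ₜ (0, m) := rfl

theorem Qpair_apply (x y : V F M) :
    Qpair F M x y = Algebra.trace ℚ F (x.1 y.2) + Algebra.trace ℚ F (y.1 x.2) := by
  obtain ⟨h, m⟩ := x
  obtain ⟨h', m'⟩ := y
  simp [Qpair, Q, QuadraticMap.polar]
  ring

theorem pairA_comm (x y : VA F M A) : pairA F M A x y = pairA F M A y x := by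
  induction x using TensorProduct.induction_on with
  | zero => simp
  | add x x' hx hx' => simp [hx, hx']
  | tmul a v =>
    induction y using TensorProduct.induction_on with
    | zero => simp
    | add y y' hy hy' => simp [hy, hy']
    | tmul b w =>
      rw [LinearMap.BilinForm.baseChange_tmul, LinearMap.BilinForm.baseChange_tmul, Qpair_apply,
        Qpair_apply, mul_comm, add_comm]

theorem polar_QA (x y : VA F M A) : QuadraticMap.polar (QA F M A) x y = pairA F M A x y := by
  have : CharZero A := algebraRat.charZero A
  have : Invertible (2 : A) := invertibleOfNonzero two_ne_zero
  rw [← QuadraticMap.polarBilin_apply_apply, QuadraticForm.polarBilin_baseChange]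
  rfl

theorem pairA_inH_inH (h h' : A ⊗[ℚ] Module.Dual F M) :
    pairA F M A (inH F M A h) (inH F M A h') = 0 := by
  induction h with
  | zero => simp
  | add x x' hx hx' => simp [hx, hx']
  | tmul a v =>
    induction h' with
    | zero => simp
    | add y y' hy hy' => rw [map_add, map_add, hy, hy', add_zero]
    | tmul b w =>
      rw [inH_tmul, inH_tmul, LinearMap.BilinForm.baseChange_tmul, Qpair_apply]; simp

theorem pairA_inM_inM (h h' : A ⊗[ℚ] M) :
    pairA F M A (inM F M A h) (inM F M A h') = 0 := by
  induction h with
  | zero => simp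
  | add x x' hx hx' => simp [hx, hx']
  | tmul a v =>
    induction h' with
    | zero => simp
    | add y y' hy hy' => rw [map_add, map_add, hy, hy', add_zero]
    | tmul b w =>
      rw [inM_tmul, inM_tmul, LinearMap.BilinForm.baseChange_tmul, Qpair_apply]; simp

theorem two_mul_QA (x : VA F M A) : 2 * QA F M A x = pairA F M A x x := by
  rw [← polar_QA, QuadraticMap.polar_self, two_mul, two_smul]

theorem QA_inH (h : A ⊗[ℚ] Module.Dual F M) : QA F M A (inH F M A h) = 0 := by
  have : CharZero A := algebraRat.charZero A
  have := two_mul_QA (inH F M A h)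
  rw [pairA_inH_inH] at this
  simpa using this

theorem QA_inM (m : A ⊗[ℚ] M) : QA F M A (inM F M A m) = 0 := by
  have : CharZero A := algebraRat.charZero A
  have := two_mul_QA (inM F M A m)
  rw [pairA_inM_inM] at this
  simpa using this

theorem cl_tmul (a z : A) (v : V F M) (s : S F M) :
    cl F M A (a ⊗ₜ v) (z ⊗ₜ s) = (a * z) ⊗ₜ spinMap F M v s := by
  have : CliffordAlgebra.equivBaseChange A (Q F M) (CliffordAlgebra.ι (QA F M A) (a ⊗ₜ v)) =
      a ⊗ₜ CliffordAlgebra.ι (Q F M) v := CliffordAlgebra.toBaseChange_ι A (Q F M) a v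
  simp only [cl, LinearMap.comp_apply, AlgHom.toLinearMap_apply, spinRepA, AlgHom.comp_apply]
  erw [this]
  refine (congrArg (fun f : Module.End A (A ⊗[ℚ] S F M) => f (z ⊗ₜ s))
    (Algebra.TensorProduct.lift_tmul _ _ _ a (CliffordAlgebra.ι (Q F M) v))).trans ?_
  rw [Algebra.ofId_apply, Module.End.mul_apply, Module.algebraMap_end_apply, spinRep,
    AlgHom.comp_apply, CliffordAlgebra.lift_ι_apply]
  change a • (z ⊗ₜ[ℚ] spinMap F M v s) = _
  rw [TensorProduct.smul_tmul', smul_eq_mul]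

theorem cl_mul_cl_add (v w : VA F M A) (s : A ⊗[ℚ] S F M) :
    cl F M A v (cl F M A w s) + cl F M A w (cl F M A v s) = pairA F M A v w • s := by
  have := congrArg (fun x => spinRepA F M A x s)
    (CliffordAlgebra.ι_mul_ι_add_swap (Q := QA F M A) v w)
  rw [polar_QA] at this
  simpa [cl, Module.algebraMap_end_apply] using this

theorem cl_mul_cl_self (v : VA F M A) (s : A ⊗[ℚ] S F M) :
    cl F M A v (cl F M A v s) = QA F M A v • s := by
  have := congrArg (fun x => spinRepA F M A x s) (CliffordAlgebra.ι_sq_scalar (QA F M A) v)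
  simp only [map_mul, AlgHom.commutes, Module.algebraMap_end_apply] at this
  exact this

theorem spinMap_inl (h : Module.Dual F M) (s : S F M) :
    spinMap F M (h, 0) s = ExteriorAlgebra.ι ℚ h * s := by simp [spinMap]

theorem spinMap_inr_one (m : M) : spinMap F M (0, m) 1 = 0 := by
  have := CliffordAlgebra.contractLeft_one (Q := (0 : QuadraticForm ℚ (Module.Dual F M)))
    (evalTr F M m)
  simp only [spinMap, LinearMap.add_apply, LinearMap.comp_apply, LinearMap.fst_apply, map_zero,
    LinearMap.snd_apply, zero_add]
  exact this

@[simp] theorem vac_tmul (z : A) (s : S F M) :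
    vac F M A (z ⊗ₜ s) = algebraMap ℚ A (ExteriorAlgebra.algebraMapInv s) * z := by
  simp [vac, Algebra.smul_def]

theorem vac_cl_inH (h : A ⊗[ℚ] Module.Dual F M) (s : A ⊗[ℚ] S F M) :
    vac F M A (cl F M A (inH F M A h) s) = 0 := by
  induction h with
  | zero => simp
  | add x x' hx hx' => simp [hx, hx']
  | tmul a v =>
    induction s with
    | zero => simp
    | add y y' hy hy' => rw [map_add, map_add, hy, hy', add_zero]
    | tmul b w =>
      rw [inH_tmul, cl_tmul, spinMap_inl, vac_tmul, map_mul]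
      simp [ExteriorAlgebra.algebraMapInv]

theorem cl_inM_cl_inH (h : A ⊗[ℚ] Module.Dual F M) (m : A ⊗[ℚ] M) (s : A ⊗[ℚ] S F M) :
    cl F M A (inM F M A m) (cl F M A (inH F M A h) s) =
      pairA F M A (inM F M A m) (inH F M A h) • s -
        cl F M A (inH F M A h) (cl F M A (inM F M A m) s) := by
  rw [eq_sub_iff_add_eq, cl_mul_cl_add]

/-! ### Spinors determined by their degree-zero component -/

section Vacuum
variable (F M)

/-- The basis of `H¹(X, ℚ)` dual to the chosen basis of `H₁(X, ℚ)`. -/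
def dualFamily (i : Fin (Module.finrank ℚ M)) : Module.Dual F M :=
  (LinearEquiv.ofBijective (traceDual F M) traceDual_bijective).symm
    ((Module.finBasis ℚ M).coord i)

variable {F M}

theorem traceDual_dualFamily (i : Fin (Module.finrank ℚ M)) :
    traceDual F M (dualFamily F M i) = (Module.finBasis ℚ M).coord i :=
  (LinearEquiv.ofBijective (traceDual F M) traceDual_bijective).apply_symm_apply _

theorem trace_dualFamily (i j : Fin (Module.finrank ℚ M)) :
    Algebra.trace ℚ F (dualFamily F M i (Module.finBasis ℚ M j)) = if i = j then 1 else 0 := by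
  rw [← traceDual_apply, traceDual_dualFamily]
  simp [Finsupp.single_apply, eq_comm]

theorem eq_sum_dualFamily (h : Module.Dual F M) :
    h = ∑ i, traceDual F M h (Module.finBasis ℚ M i) • dualFamily F M i := by
  apply traceDual_bijective.injective
  rw [map_sum]
  refine (Module.finBasis ℚ M).ext fun j => ?_
  simp [traceDual_dualFamily, -traceDual_apply]

variable (F M A)

/-- Contraction with a vector of the chosen basis. -/
def contr (i : Fin (Module.finrank ℚ M)) : Module.End A (A ⊗[ℚ] S F M) :=
  cl F M A (inM F M A (1 ⊗ₜ Module.finBasis ℚ M i))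

/-- Exterior multiplication with a vector of the dual basis. -/
def wedge (i : Fin (Module.finrank ℚ M)) : Module.End A (A ⊗[ℚ] S F M) :=
  cl F M A (inH F M A (1 ⊗ₜ dualFamily F M i))

variable {F M A}

theorem contr_wedge (i j : Fin (Module.finrank ℚ M)) (s : A ⊗[ℚ] S F M) :
    contr F M A i (wedge F M A j s) =
      (if i = j then s else 0) - wedge F M A j (contr F M A i s) := by
  rw [contr, wedge, cl_inM_cl_inH, inM_tmul, inH_tmul, LinearMap.BilinForm.baseChange_tmul,
    Qpair_apply]
  simp only [map_zero, zero_add, trace_dualFamily, eq_comm (a := j)]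
  split_ifs <;> simp

theorem wedge_wedge (i j : Fin (Module.finrank ℚ M)) (s : A ⊗[ℚ] S F M) :
    wedge F M A i (wedge F M A j s) = -wedge F M A j (wedge F M A i s) := by
  rw [eq_neg_iff_add_eq_zero, wedge, wedge, cl_mul_cl_add, pairA_inH_inH, zero_smul]

theorem wedge_wedge_self (i : Fin (Module.finrank ℚ M)) (s : A ⊗[ℚ] S F M) :
    wedge F M A i (wedge F M A i s) = 0 := by
  rw [wedge, cl_mul_cl_self, QA_inH, zero_smul]

theorem contr_contr (i j : Fin (Module.finrank ℚ M)) (s : A ⊗[ℚ] S F M) :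
    contr F M A i (contr F M A j s) = -contr F M A j (contr F M A i s) := by
  rw [eq_neg_iff_add_eq_zero, contr, contr, cl_mul_cl_add, pairA_inM_inM, zero_smul]

theorem contr_contr_self (i : Fin (Module.finrank ℚ M)) (s : A ⊗[ℚ] S F M) :
    contr F M A i (contr F M A i s) = 0 := by
  rw [contr, cl_mul_cl_self, QA_inM, zero_smul]

theorem contr_one (i : Fin (Module.finrank ℚ M)) : contr F M A i ((1 : A) ⊗ₜ (1 : S F M)) = 0 := by
  rw [contr, inM_tmul, cl_tmul, spinMap_inr_one, TensorProduct.tmul_zero]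

variable (F M A) in
/-- The span of `1` and of the ideals generated by the members of the dual basis with index in `T`. -/
def vacSpan (T : Finset (Fin (Module.finrank ℚ M))) : Submodule A (A ⊗[ℚ] S F M) :=
  Submodule.span A {(1 : A) ⊗ₜ (1 : S F M)} ⊔ ⨆ i ∈ T, LinearMap.range (wedge F M A i)

theorem wedge_mem_vacSpan {T : Finset (Fin (Module.finrank ℚ M))} {i : Fin (Module.finrank ℚ M)}
    (hi : i ∈ T) (s : A ⊗[ℚ] S F M) : wedge F M A i s ∈ vacSpan F M A T :=
  Submodule.mem_sup_right <| (le_iSup₂_of_le (f := fun i (_ : i ∈ T) =>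
    LinearMap.range (wedge F M A i)) i hi le_rfl) ⟨s, rfl⟩

theorem vacSpan_univ (s : A ⊗[ℚ] S F M) : s ∈ vacSpan F M A Finset.univ := by
  induction s with
  | zero => exact zero_mem _
  | add x y hx hy => exact add_mem hx hy
  | tmul z s =>
    induction s using CliffordAlgebra.left_induction with
    | algebraMap r =>
      refine Submodule.mem_sup_left (Submodule.mem_span_singleton.mpr ⟨r • z, ?_⟩)
      rw [TensorProduct.smul_tmul', smul_eq_mul, mul_one, TensorProduct.smul_tmul,
        Algebra.algebraMap_eq_smul_one]
    | add x y hx hy => rw [TensorProduct.tmul_add]; exact add_mem hx hy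
    | ι_mul s h _ =>
      have : z ⊗ₜ[ℚ] (CliffordAlgebra.ι 0 h * s : S F M) = ∑ i,
          wedge F M A i (traceDual F M h (Module.finBasis ℚ M i) • z ⊗ₜ s) := by
        conv_lhs => rw [eq_sum_dualFamily h, map_sum, Finset.sum_mul, TensorProduct.tmul_sum]
        refine Finset.sum_congr rfl fun i _ => ?_
        rw [wedge, inH_tmul, TensorProduct.smul_tmul', cl_tmul, spinMap_inl, one_mul, map_smul,
          smul_mul_assoc, TensorProduct.smul_tmul]
      rw [this]
      exact sum_mem fun i _ => wedge_mem_vacSpan (Finset.mem_univ _) _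

/-- A spinor killed by contraction with index `j` is fixed by `contr j * wedge j`. This operator
fixes `1`, kills the range of `wedge j` and preserves the other ranges, so the index `j` can be
dropped from `T`. -/
theorem mem_span_one_of_contr_eq_zero (T : Finset (Fin (Module.finrank ℚ M))) (s : A ⊗[ℚ] S F M)
    (h0 : ∀ i, contr F M A i s = 0) (hs : s ∈ vacSpan F M A T) :
    s ∈ Submodule.span A {(1 : A) ⊗ₜ (1 : S F M)} := by
  induction T using Finset.induction_on with
  | empty => simpa [vacSpan] using hs
  | insert j T hj ih =>
    apply ih
    have e : contr F M A j (wedge F M A j s) = s := by rw [contr_wedge, h0]; simp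
    rw [← e]
    have le : vacSpan F M A (insert j T) ≤
        (vacSpan F M A T).comap (contr F M A j * wedge F M A j) := by
      rw [vacSpan, sup_le_iff, Submodule.span_singleton_le_iff_mem, iSup₂_le_iff]
      refine ⟨?_, fun i hi => ?_⟩
      · rw [Submodule.mem_comap, Module.End.mul_apply, contr_wedge, contr_one, map_zero, sub_zero,
          if_pos rfl]
        exact Submodule.mem_sup_left (Submodule.mem_span_singleton_self _)
      · rintro _ ⟨t, rfl⟩
        rw [Submodule.mem_comap, Module.End.mul_apply]
        by_cases hij : i = j
        · subst hij
          rw [wedge_wedge_self, map_zero]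
          exact zero_mem _
        · rw [wedge_wedge, map_neg, contr_wedge, if_neg (Ne.symm hij), zero_sub, neg_neg]
          exact wedge_mem_vacSpan (Finset.mem_of_mem_insert_of_ne hi hij) _
    exact le hs

/-- A nonzero spinor can be contracted down to a nonzero scalar, which `vac` detects. The induction
is on the number of indices not known to kill `s`: contracting with a new index `k` enlarges the
known set, so the result vanishes, and then `k` itself kills `s`. -/
theorem eq_zero_of_contr_stable (N : Submodule A (A ⊗[ℚ] S F M))
    (hN : ∀ s ∈ N, ∀ i, contr F M A i s ∈ N) (hv : ∀ s ∈ N, vac F M A s = 0) :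
    ∀ s ∈ N, s = 0 := by
  have key : ∀ n, ∀ T : Finset (Fin (Module.finrank ℚ M)), Tᶜ.card = n → ∀ s ∈ N,
      (∀ i ∈ T, contr F M A i s = 0) → s = 0 := by
    intro n
    induction n with
    | zero =>
      intro T hT s hs h0
      rw [Finset.card_eq_zero, Finset.compl_eq_empty_iff] at hT
      subst hT
      obtain ⟨a, rfl⟩ := Submodule.mem_span_singleton.mp
        (mem_span_one_of_contr_eq_zero Finset.univ s (fun i => h0 i (Finset.mem_univ _))
          (vacSpan_univ s))
      have := hv _ hs
      simp at this
      simp [this]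
    | succ n ih =>
      intro T hT s hs h0
      obtain ⟨k, hk⟩ := Finset.card_pos.mp (by omega : 0 < Tᶜ.card)
      have hc : (insert k T)ᶜ.card = n := by
        rw [Finset.compl_insert, Finset.card_erase_of_mem hk, hT]; rfl
      refine ih _ hc s hs fun i hi => ?_
      rcases Finset.mem_insert.mp hi with rfl | hi
      · refine ih _ hc _ (hN s hs i) fun l hl => ?_
        rcases Finset.mem_insert.mp hl with rfl | hl
        · exact contr_contr_self _ _
        · rw [contr_contr, h0 l hl, map_zero, neg_zero]
      · exact h0 i hi
  exact fun s hs => key _ ∅ rfl s hs (by simp)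

variable (F M A) in
/-- The spinors all of whose contractions with at most `n` vectors have vanishing component of degree
zero. -/
def contrFilt : ℕ → Submodule A (A ⊗[ℚ] S F M)
  | 0 => LinearMap.ker (vac F M A)
  | n + 1 => LinearMap.ker (vac F M A) ⊓
      ⨅ m : A ⊗[ℚ] M, (contrFilt n).comap (cl F M A (inM F M A m))

theorem mem_contrFilt_succ {n : ℕ} {s : A ⊗[ℚ] S F M} : s ∈ contrFilt F M A (n + 1) ↔
    vac F M A s = 0 ∧ ∀ m, cl F M A (inM F M A m) s ∈ contrFilt F M A n := by
  simp [contrFilt]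

theorem contrFilt_succ_le (n : ℕ) : contrFilt F M A (n + 1) ≤ contrFilt F M A n := by
  induction n with
  | zero => exact inf_le_left
  | succ n ih =>
    intro s hs
    rw [mem_contrFilt_succ] at hs ⊢
    exact ⟨hs.1, fun m => ih (hs.2 m)⟩

/-- A wedge product has no degree-zero part and anticommutes with contractions up to a scalar, so
wedging gains one step of the filtration. -/
theorem cl_inH_mem_contrFilt (h : A ⊗[ℚ] Module.Dual F M) {n : ℕ} {s : A ⊗[ℚ] S F M}
    (hs : s ∈ contrFilt F M A n) : cl F M A (inH F M A h) s ∈ contrFilt F M A (n + 1) := by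
  induction n generalizing s with
  | zero =>
    rw [mem_contrFilt_succ]
    refine ⟨vac_cl_inH _ _, fun m => ?_⟩
    rw [cl_inM_cl_inH]
    exact sub_mem (Submodule.smul_mem _ _ hs) (vac_cl_inH _ _)
  | succ n ih =>
    rw [mem_contrFilt_succ]
    refine ⟨vac_cl_inH _ _, fun m => ?_⟩
    rw [cl_inM_cl_inH]
    exact sub_mem (Submodule.smul_mem _ _ hs) (ih ((mem_contrFilt_succ.mp hs).2 m))

/-- A spinor annihilated by a graph over `H₁(X, A)` is determined by its component of degree zero. -/
theorem eq_zero_of_vac_eq_zero (s : A ⊗[ℚ] S F M) (hv : vac F M A s = 0)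
    (hs : ∀ m, ∃ h, cl F M A (inH F M A h + inM F M A m) s = 0) : s = 0 := by
  -- The annihilation hypothesis turns contraction with `m` into `-h ∧ s`. Wedging raises the
  -- filtration while contraction need only stay at level `n`, so membership bootstraps from `vac s
  -- = 0` to all levels.
  have key : ∀ n, s ∈ contrFilt F M A n := by
    intro n
    induction n with
    | zero => exact hv
    | succ n ih =>
      refine mem_contrFilt_succ.mpr ⟨hv, fun m => ?_⟩
      obtain ⟨h, hh⟩ := hs m
      rw [map_add, LinearMap.add_apply, add_comm, add_eq_zero_iff_eq_neg] at hh
      rw [hh]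
      exact neg_mem (contrFilt_succ_le _ (cl_inH_mem_contrFilt h ih))
  refine eq_zero_of_contr_stable (⨅ n, contrFilt F M A n) ?_ ?_ s
    ((Submodule.mem_iInf _).mpr key)
  · intro t ht i
    rw [Submodule.mem_iInf] at ht ⊢
    exact fun n => (mem_contrFilt_succ.mp (ht (n + 1))).2 _
  · intro t ht
    rw [Submodule.mem_iInf] at ht
    exact ht 0

end Vacuum
end SpinRep

/-! ### Complexification -/

section Complexify
variable {U : Type*} [AddCommGroup U] [Module ℚ U]

/-- The inclusion `ℝ ⊗ U → ℂ ⊗ U`. -/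
def inclC (U : Type*) [AddCommGroup U] [Module ℚ U] : ℝ ⊗[ℚ] U →ₗ[ℝ] ℂ ⊗[ℚ] U :=
  TensorProduct.AlgebraTensorModule.map (Algebra.linearMap ℝ ℂ) LinearMap.id

@[simp] theorem inclC_tmul (r : ℝ) (u : U) : inclC U (r ⊗ₜ u) = (r : ℂ) ⊗ₜ u := rfl

theorem complexify_tmul (f : Module.End ℝ (ℝ ⊗[ℚ] U)) (z : ℂ) (u : U) :
    complexify f (z ⊗ₜ u) = z • inclC U (f (1 ⊗ₜ u)) := by
  have h : ∀ x : ℝ ⊗[ℚ] U, TensorProduct.AlgebraTensorModule.cancelBaseChange ℚ ℝ ℂ ℂ U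
      (z ⊗ₜ[ℝ] x) = z • inclC U x := by
    intro x
    induction x with
    | zero => simp
    | add x y hx hy => rw [TensorProduct.tmul_add, map_add, hx, hy, map_add, smul_add]
    | tmul r u =>
      rw [TensorProduct.AlgebraTensorModule.cancelBaseChange_tmul, inclC_tmul,
        TensorProduct.smul_tmul', Algebra.smul_def, smul_eq_mul, mul_comm]
      rfl
  rw [complexify, LinearEquiv.conj_apply_apply,
    TensorProduct.AlgebraTensorModule.cancelBaseChange_symm_tmul, LinearMap.baseChange_tmul, h]

theorem complexify_inclC (f : Module.End ℝ (ℝ ⊗[ℚ] U)) (x : ℝ ⊗[ℚ] U) :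
    complexify f (inclC U x) = inclC U (f x) := by
  induction x with
  | zero => simp
  | add x y hx hy => simp only [map_add, hx, hy]
  | tmul r u =>
    have : r ⊗ₜ[ℚ] u = r • ((1 : ℝ) ⊗ₜ[ℚ] u) := by simp [TensorProduct.smul_tmul']
    rw [inclC_tmul, complexify_tmul, this, map_smul, map_smul]
    rfl

theorem inclC_induction {P : ℂ ⊗[ℚ] U → Prop} (h0 : P 0) (ha : ∀ x y, P x → P y → P (x + y))
    (ht : ∀ (z : ℂ) (u : ℝ ⊗[ℚ] U), P (z • inclC U u)) (x : ℂ ⊗[ℚ] U) : P x := by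
  induction x with
  | zero => exact h0
  | add x y hx hy => exact ha _ _ hx hy
  | tmul z u => simpa [TensorProduct.smul_tmul'] using ht z (1 ⊗ₜ u)

theorem complexify_mul (f g : Module.End ℝ (ℝ ⊗[ℚ] U)) :
    complexify (f * g) = complexify f * complexify g := by
  refine LinearMap.ext fun x => ?_
  induction x using inclC_induction with
  | h0 => simp
  | ha x y hx hy => rw [map_add, map_add, hx, hy]
  | ht z u => simp only [map_smul, complexify_inclC, Module.End.mul_apply]

theorem complexify_neg (f : Module.End ℝ (ℝ ⊗[ℚ] U)) : complexify (-f) = -complexify f := by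
  refine LinearMap.ext fun x => ?_
  induction x using inclC_induction with
  | h0 => simp
  | ha x y hx hy => rw [map_add, map_add, hx, hy]
  | ht z u => simp only [map_smul, complexify_inclC, LinearMap.neg_apply, map_neg]

theorem complexify_one : complexify (1 : Module.End ℝ (ℝ ⊗[ℚ] U)) = 1 := by
  refine LinearMap.ext fun x => ?_
  induction x using inclC_induction with
  | h0 => simp
  | ha x y hx hy => rw [map_add, map_add, hx, hy]
  | ht z u => simp only [map_smul, complexify_inclC, Module.End.one_apply]

theorem complexify_baseChange (f : Module.End ℚ U) :
    complexify (f.baseChange ℝ) = f.baseChange ℂ := by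
  refine LinearMap.ext fun x => ?_
  induction x with
  | zero => simp
  | add x y hx hy => rw [map_add, map_add, hx, hy]
  | tmul z u => simp [complexify_tmul, TensorProduct.smul_tmul']

theorem inclC_injective : Function.Injective (inclC U) := by
  have : Function.Injective (LinearMap.rTensor U ((Algebra.linearMap ℝ ℂ).restrictScalars ℚ)) :=
    Module.Flat.rTensor_preserves_injective_linearMap _ Complex.ofReal_injective
  exact this

end Complexify

/-! ### Triviality on the secant space -/

section Secant
variable {F K M : Type*} [Field F] [NumberField F] [IsTotallyReal F] [Field K] [NumberField K]
  [IsTotallyComplex K] [Algebra F K] [Algebra.IsQuadraticExtension F K]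
  [AddCommGroup M] [Module ℚ M] [Module F M] [Module.Finite ℚ M]
  {X : Torus F M} (Θ : Polarization X) (D : ImagGenerator F K)

theorem cl_inclC (v : VA F M ℝ) (s : ℝ ⊗[ℚ] S F M) :
    cl F M ℂ (inclC (V F M) v) (inclC (S F M) s) = inclC (S F M) (cl F M ℝ v s) := by
  induction v using TensorProduct.induction_on with
  | zero => simp
  | add x y hx hy => simp only [map_add, LinearMap.add_apply, hx, hy]
  | tmul r v =>
    induction s with
    | zero => simp
    | add x y hx hy => rw [map_add, map_add, map_add, map_add, hx, hy]
    | tmul r' s => rw [inclC_tmul, inclC_tmul, cl_tmul, cl_tmul, inclC_tmul, Complex.ofReal_mul]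

theorem vac_inclC (s : ℝ ⊗[ℚ] S F M) :
    vac F M ℂ (inclC (S F M) s) = (vac F M ℝ s : ℂ) := by
  induction s with
  | zero => simp
  | add x y hx hy => simp only [map_add, Complex.ofReal_add, hx, hy]
  | tmul r' s => simp

theorem complexify_cl {f : Module.End ℝ (VA F M ℝ)} {G : Module.End ℝ (ℝ ⊗[ℚ] S F M)}
    (h : ∀ v s, G (cl F M ℝ v s) = cl F M ℝ (f v) (G s)) (v : VA F M ℂ) (s : ℂ ⊗[ℚ] S F M) :
    complexify G (cl F M ℂ v s) = cl F M ℂ (complexify f v) (complexify G s) := by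
  induction v using inclC_induction with
  | h0 => simp
  | ha x y hx hy => simp only [map_add, LinearMap.add_apply, hx, hy]
  | ht z v =>
    induction s using inclC_induction with
    | h0 => simp
    | ha x y hx hy => simp only [map_add, hx, hy]
    | ht z' s =>
      simp only [map_smul, LinearMap.smul_apply, cl_inclC, complexify_inclC, h]

theorem vac_complexify {G : Module.End ℝ (ℝ ⊗[ℚ] S F M)}
    (h : ∀ s, vac F M ℝ (G s) = vac F M ℝ s) (s : ℂ ⊗[ℚ] S F M) :
    vac F M ℂ (complexify G s) = vac F M ℂ s := by
  induction s using inclC_induction with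
  | h0 => simp
  | ha x y hx hy => simp only [map_add, hx, hy]
  | ht z' s => simp only [map_smul, complexify_inclC, vac_inclC, h]

theorem mem_ellT {T : CMType F K} {s : ℂ ⊗[ℚ] S F M} :
    s ∈ ellT Θ D T ↔ ∀ w ∈ WT Θ D T, cl F M ℂ w s = 0 := by
  simp [ellT, cl]

/-- A transformation of the spinors that covers `f`, where `f` preserves all the `W_T`, and that
preserves the component of degree zero, fixes the secant space. -/
theorem fixes_B {f : Module.End ℝ (VA F M ℝ)} {G : Module.End ℝ (ℝ ⊗[ℚ] S F M)}
    (hG : ∀ v s, G (cl F M ℝ v s) = cl F M ℝ (f v) (G s))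
    (hvac : ∀ s, vac F M ℝ (G s) = vac F M ℝ s)
    (hW : ∀ T : CMType F K, ∀ w ∈ WT Θ D T, ∃ w' ∈ WT Θ D T, complexify f w' = w)
    (hgraph : ∀ (T : CMType F K) (m : ℂ ⊗[ℚ] M), ∃ h, inH F M ℂ h + inM F M ℂ m ∈ WT Θ D T)
    {b : S F M} (hb : b ∈ B Θ D) : G (1 ⊗ₜ b) = 1 ⊗ₜ b := by
  -- By definition `1 ⊗ b` lies in the sum of the `ℓ_T` over `ℂ`, so it is enough to fix each of
  -- these pointwise.
  have key : ⨆ T : CMType F K, ellT Θ D T ≤ LinearMap.ker (complexify G - 1) := by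
    refine iSup_le fun T s hs => ?_
    rw [LinearMap.mem_ker, LinearMap.sub_apply, Module.End.one_apply]
    -- `G` carries the annihilator of `W_T` to the annihilator of its image, again `W_T`. The
    -- difference stays in `ℓ_T` and has no degree-zero part, so it vanishes.
    have h1 : complexify G s - s ∈ ellT Θ D T := by
      refine sub_mem ?_ hs
      rw [mem_ellT] at hs ⊢
      intro w hw
      obtain ⟨w', hw', rfl⟩ := hW T w hw
      rw [← complexify_cl hG, hs w' hw', map_zero]
    refine eq_zero_of_vac_eq_zero _ (by rw [map_sub, vac_complexify hvac, sub_self]) fun m => ?_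
    obtain ⟨h, hh⟩ := hgraph T m
    exact ⟨h, (mem_ellT Θ D).mp h1 _ hh⟩
  have h2 := key hb
  rw [LinearMap.mem_ker, LinearMap.sub_apply, Module.End.one_apply, sub_eq_zero] at h2
  apply inclC_injective
  rw [← complexify_inclC]
  simpa using h2

end Secant

/-! ### Isotypic decomposition of `A ⊗ U` for a vector space `U` over a number field -/

section Isotypic
variable (L : Type*) [Field L] [NumberField L]

/-- The basis dual to the chosen rational basis of `L`, for the trace form. -/
def trBasis : Module.Basis (Fin (Module.finrank ℚ L)) ℚ L :=
  (Algebra.traceForm ℚ L).dualBasis (traceForm_nondegenerate ℚ L) (Module.finBasis ℚ L)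

theorem trace_trBasis_mul (i j : Fin (Module.finrank ℚ L)) :
    Algebra.trace ℚ L (trBasis L i * Module.finBasis ℚ L j) = if j = i then 1 else 0 :=
  LinearMap.BilinForm.apply_dualBasis_left (traceForm_nondegenerate ℚ L) _ i j

variable {L}

theorem sum_trace_mul_trBasis (x : L) :
    ∑ i, Algebra.trace ℚ L (x * trBasis L i) • Module.finBasis ℚ L i = x := by
  conv_rhs => rw [← (Module.finBasis ℚ L).sum_repr x]
  refine Finset.sum_congr rfl fun i _ => ?_
  congr 1
  conv_lhs => rw [← (Module.finBasis ℚ L).sum_repr x]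
  rw [Finset.sum_mul, map_sum]
  simp [mul_comm _ (trBasis L i), trace_trBasis_mul]

theorem sum_trace_mul_finBasis (x : L) :
    ∑ i, Algebra.trace ℚ L (x * Module.finBasis ℚ L i) • trBasis L i = x := by
  conv_rhs => rw [← (trBasis L).sum_repr x]
  refine Finset.sum_congr rfl fun i _ => ?_
  congr 1
  conv_lhs => rw [← (trBasis L).sum_repr x]
  rw [Finset.sum_mul, map_sum]
  simp [trace_trBasis_mul]

variable {A : Type*} [Field A] [Algebra ℚ A]

theorem map_rat_smul' (σ : L →+* A) (c : ℚ) (x : L) : σ (c • x) = algebraMap ℚ A c * σ x := by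
  rw [Algebra.smul_def, map_mul]; simp

/-- The coefficients of orthogonality between embeddings. -/
theorem sum_embedding_mul (σ τ : L →+* A) (l : L) :
    ∑ i, σ (trBasis L i) * τ (l * Module.finBasis ℚ L i) =
      ∑ i, σ (l * trBasis L i) * τ (Module.finBasis ℚ L i) := by
  -- Multiplication by `l` is self-adjoint for the trace form, so its matrices in a basis and in the
  -- dual basis are transposes. This is the identity `∑ eᵢ* ⊗ l eᵢ = ∑ l eᵢ* ⊗ eᵢ` in `L ⊗ L`.
  have h1 : ∀ i, τ (l * Module.finBasis ℚ L i) = ∑ j,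
      algebraMap ℚ A (Algebra.trace ℚ L (l * Module.finBasis ℚ L i * trBasis L j)) *
        τ (Module.finBasis ℚ L j) := by
    intro i
    conv_lhs => rw [← sum_trace_mul_trBasis (l * Module.finBasis ℚ L i), map_sum]
    simp only [map_rat_smul']
  have h2 : ∀ j, σ (l * trBasis L j) = ∑ i,
      algebraMap ℚ A (Algebra.trace ℚ L (l * Module.finBasis ℚ L i * trBasis L j)) *
        σ (trBasis L i) := by
    intro j
    conv_lhs => rw [← sum_trace_mul_finBasis (l * trBasis L j), map_sum]
    simp only [map_rat_smul', mul_right_comm]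
  simp only [h1, h2, Finset.mul_sum, Finset.sum_mul]
  rw [Finset.sum_comm]
  refine Finset.sum_congr rfl fun i _ => Finset.sum_congr rfl fun j _ => by ring

/-- The element `∑ eᵢ* ⊗ eᵢ` is killed by `l ⊗ 1 - 1 ⊗ l`, so its image under `σ ⊗ τ` is killed by
`σ l - τ l`, nonzero for a suitable `l`. -/
theorem sum_embedding_of_ne {σ τ : L →+* A} (h : σ ≠ τ) :
    ∑ i, σ (trBasis L i) * τ (Module.finBasis ℚ L i) = 0 := by
  obtain ⟨l, hl⟩ := DFunLike.ne_iff.mp h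
  have := sum_embedding_mul σ τ l
  simp only [map_mul] at this
  have h2 : (σ l - τ l) * ∑ i, σ (trBasis L i) * τ (Module.finBasis ℚ L i) = 0 := by
    rw [sub_mul, Finset.mul_sum, Finset.mul_sum, sub_eq_zero]
    convert this.symm using 2 <;> ring_nf
  exact (mul_eq_zero.mp h2).resolve_left (sub_ne_zero.mpr hl)

variable (L A) in
/-- `A` contains all conjugates of `L`, in the form of the trace formula. -/
def TraceSplits [Fintype (L →+* A)] : Prop :=
  ∀ x : L, algebraMap ℚ A (Algebra.trace ℚ L x) = ∑ σ : L →+* A, σ x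

/-- By orthogonality the left side may be summed over all embeddings in the first factor. That
produces the traces of the `eᵢ*`, which are the coordinates of `1` in the basis `eᵢ`. -/
theorem sum_embedding_self [Fintype (L →+* A)] (hA : TraceSplits L A) (σ : L →+* A) :
    ∑ i, σ (trBasis L i) * σ (Module.finBasis ℚ L i) = 1 := by
  classical
  have h1 : ∑ τ : L →+* A, ∑ i, τ (trBasis L i) * σ (Module.finBasis ℚ L i) =
      ∑ i, σ (trBasis L i) * σ (Module.finBasis ℚ L i) :=
    Finset.sum_eq_single σ (fun τ _ h => sum_embedding_of_ne h) (by simp)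
  rw [← h1, Finset.sum_comm]
  simp only [← Finset.sum_mul, ← hA _]
  have := congrArg σ (sum_trace_mul_trBasis (1 : L))
  simpa [map_sum, map_rat_smul'] using this

variable (A) {U : Type*} [AddCommGroup U] [Module ℚ U] [Module L U]

/-- The action of `l ∈ L` on `A ⊗ U`. -/
def actA (l : L) : Module.End A (A ⊗[ℚ] U) := ((LinearMap.lsmul L U l).restrictScalars ℚ).baseChange A

@[simp] theorem actA_tmul (l : L) (a : A) (u : U) : actA A l (a ⊗ₜ u) = a ⊗ₜ (l • u) := rfl

theorem actA_mul (l l' : L) : actA A (U := U) (l * l') = actA A l * actA A l' := by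
  refine LinearMap.ext fun x => ?_
  induction x with
  | zero => simp
  | add x y hx hy => rw [map_add, map_add, hx, hy]
  | tmul a u => simp [mul_smul]

theorem actA_rat_smul (c : ℚ) (l : L) :
    actA A (U := U) (c • l) = algebraMap ℚ A c • actA A l := by
  refine LinearMap.ext fun x => ?_
  induction x with
  | zero => simp
  | add x y hx hy => rw [map_add, map_add, hx, hy]
  | tmul a u =>
    rw [LinearMap.smul_apply, actA_tmul, actA_tmul, smul_assoc, ← TensorProduct.smul_tmul,
      TensorProduct.smul_tmul', Algebra.smul_def, smul_eq_mul]

theorem actA_add (l l' : L) : actA A (U := U) (l + l') = actA A l + actA A l' := by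
  refine LinearMap.ext fun x => ?_
  induction x with
  | zero => simp
  | add x y hx hy => rw [map_add, map_add, hx, hy]
  | tmul a u => simp [add_smul, TensorProduct.tmul_add]

theorem actA_one : actA A (U := U) (1 : L) = 1 := by
  refine LinearMap.ext fun x => ?_
  induction x with
  | zero => simp
  | add x y hx hy => rw [map_add, map_add, hx, hy]
  | tmul a u => simp

/-- `actA` as an additive map. -/
def actAHom (U : Type*) [AddCommGroup U] [Module ℚ U] [Module L U] : L →+ Module.End A (A ⊗[ℚ] U) :=
  AddMonoidHom.mk' (actA A) (actA_add A)

variable {A}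

/-- The isotypic submodule of the embedding `σ`. -/
def isotypic (U : Type*) [AddCommGroup U] [Module ℚ U] [Module L U] (σ : L →+* A) :
    Submodule A (A ⊗[ℚ] U) :=
  ⨅ l : L, Module.End.eigenspace (actA A l) (σ l)

theorem mem_isotypic {σ : L →+* A} {x : A ⊗[ℚ] U} :
    x ∈ isotypic U σ ↔ ∀ l : L, actA A l x = σ l • x := by
  simp [isotypic]

/-- The projection onto the isotypic submodule of `σ`. -/
def isoProj (U : Type*) [AddCommGroup U] [Module ℚ U] [Module L U] (σ : L →+* A) :
    Module.End A (A ⊗[ℚ] U) :=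
  ∑ i, σ (trBasis L i) • actA A (Module.finBasis ℚ L i)

theorem isoProj_apply (σ : L →+* A) (x : A ⊗[ℚ] U) :
    isoProj U σ x = ∑ i, σ (trBasis L i) • actA A (Module.finBasis ℚ L i) x := by
  simp [isoProj]

/-- Again the self-adjointness of multiplication by `l`: it can be moved from `eᵢ`, acting on `U`,
to `eᵢ*`, where `σ` turns it into a scalar. -/
theorem isoProj_mem (σ : L →+* A) (x : A ⊗[ℚ] U) : isoProj U σ x ∈ isotypic U σ := by
  rw [mem_isotypic]
  intro l
  have h1 : ∀ i, actA A l (actA A (Module.finBasis ℚ L i) x) = ∑ j,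
      algebraMap ℚ A (Algebra.trace ℚ L (l * Module.finBasis ℚ L i * trBasis L j)) •
        actA A (Module.finBasis ℚ L j) x := by
    intro i
    rw [← Module.End.mul_apply, ← actA_mul]
    conv_lhs => rw [← sum_trace_mul_trBasis (l * Module.finBasis ℚ L i)]
    change actAHom A U _ x = _
    rw [map_sum, LinearMap.sum_apply]
    exact Finset.sum_congr rfl fun j _ => by
      change actA A _ x = _
      rw [actA_rat_smul, LinearMap.smul_apply]
  have h2 : ∀ j, σ l * σ (trBasis L j) = ∑ i,
      algebraMap ℚ A (Algebra.trace ℚ L (l * Module.finBasis ℚ L i * trBasis L j)) *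
        σ (trBasis L i) := by
    intro j
    rw [← map_mul]
    conv_lhs => rw [← sum_trace_mul_finBasis (l * trBasis L j), map_sum]
    simp only [map_rat_smul', mul_right_comm]
  rw [isoProj_apply, map_sum, Finset.smul_sum]
  simp only [map_smul, h1, smul_smul, h2, Finset.smul_sum, Finset.sum_smul]
  rw [Finset.sum_comm]
  refine Finset.sum_congr rfl fun i _ => Finset.sum_congr rfl fun j _ => by rw [mul_comm]

theorem sum_isoProj [Fintype (L →+* A)] (hA : TraceSplits L A) (x : A ⊗[ℚ] U) :
    ∑ σ : L →+* A, isoProj U σ x = x := by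
  simp only [isoProj_apply]
  rw [Finset.sum_comm]
  simp only [← Finset.sum_smul, ← hA _]
  have := congrArg (fun l => actAHom A U l x) (sum_trace_mul_trBasis (1 : L))
  simp only [map_sum, LinearMap.sum_apply, one_mul] at this
  change ∑ i, actA A _ x = actA A 1 x at this
  simp only [actA_rat_smul, LinearMap.smul_apply] at this
  rw [this, actA_one, Module.End.one_apply]

theorem isoProj_of_mem (σ τ : L →+* A) {x : A ⊗[ℚ] U} (hx : x ∈ isotypic U τ) :
    isoProj U σ x = (∑ i, σ (trBasis L i) * τ (Module.finBasis ℚ L i)) • x := by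
  rw [mem_isotypic] at hx
  simp only [isoProj_apply, hx, smul_smul, Finset.sum_smul]

theorem isoProj_of_mem_self [Fintype (L →+* A)] (hA : TraceSplits L A) (σ : L →+* A)
    {x : A ⊗[ℚ] U} (hx : x ∈ isotypic U σ) : isoProj U σ x = x := by
  rw [isoProj_of_mem σ σ hx, sum_embedding_self hA, one_smul]

theorem isoProj_tmul_smul (σ : L →+* A) (a : A) (l : L) (u : U) :
    isoProj U σ (a ⊗ₜ (l • u)) = (a * σ l) • isoProj U σ (1 ⊗ₜ u) := by
  have h := (mem_isotypic.mp (isoProj_mem σ ((1 : A) ⊗ₜ[ℚ] u))) l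
  rw [mul_smul, ← h, isoProj_apply, isoProj_apply, map_sum, Finset.smul_sum]
  refine Finset.sum_congr rfl fun i _ => ?_
  simp only [actA_tmul, TensorProduct.smul_tmul', smul_eq_mul, mul_one, smul_comm l]
  rw [mul_comm]

/-- The coordinates on the isotypic submodule of `σ` given by an `L`-basis of `U`. -/
def isoCoord {n : Type*} (b : Module.Basis n L U) (σ : L →+* A) (j : n) : A ⊗[ℚ] U →ₗ[A] A :=
  LinearMap.liftBaseChange A
    (σ.toRatAlgHom.toLinearMap ∘ₗ (b.coord j).restrictScalars ℚ)

theorem isoCoord_tmul {n : Type*} (b : Module.Basis n L U) (σ : L →+* A) (j : n) (a : A) (u : U) :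
    isoCoord b σ j (a ⊗ₜ u) = a * σ (b.repr u j) := by
  simp [isoCoord]

theorem isoProj_eq_sum {n : Type*} [Fintype n] (b : Module.Basis n L U) (σ : L →+* A)
    (x : A ⊗[ℚ] U) : isoProj U σ x = ∑ j, isoCoord b σ j x • isoProj U σ (1 ⊗ₜ b j) := by
  induction x with
  | zero => simp
  | add x y hx hy => simp only [map_add, hx, hy, add_smul, Finset.sum_add_distrib]
  | tmul a u =>
    conv_lhs => rw [← b.sum_repr u, TensorProduct.tmul_sum, map_sum]
    simp only [isoProj_tmul_smul, isoCoord_tmul]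

theorem isoCoord_isoProj [Fintype (L →+* A)] (hA : TraceSplits L A) {n : Type*} [Fintype n]
    [DecidableEq n] (b : Module.Basis n L U) (σ : L →+* A) (j k : n) :
    isoCoord b σ j (isoProj U σ (1 ⊗ₜ b k)) = if j = k then 1 else 0 := by
  rw [isoProj_apply, map_sum]
  simp only [map_smul, actA_tmul, isoCoord_tmul, one_mul, Module.Basis.repr_self, smul_eq_mul,
    Finsupp.smul_apply]
  rw [← sum_embedding_self hA σ]
  split_ifs with h
  · subst h; simp
  · simp [Ne.symm h]

/-- The isotypic submodule of `σ` is `A ⊗_{L, σ} U`. -/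
def isotypicEquiv [Fintype (L →+* A)] (hA : TraceSplits L A) {n : Type*} [Fintype n]
    [DecidableEq n] (b : Module.Basis n L U) (σ : L →+* A) : isotypic U σ ≃ₗ[A] (n → A) :=
  LinearEquiv.ofLinearMap (LinearMap.pi (isoCoord b σ) ∘ₗ (isotypic U σ).subtype)
    (LinearMap.codRestrict _
      (Fintype.linearCombination A (fun j => isoProj U σ ((1 : A) ⊗ₜ[ℚ] b j)))
      fun z => by
        rw [Fintype.linearCombination_apply]
        exact sum_mem fun j _ => Submodule.smul_mem _ _ (isoProj_mem σ _))
    (by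
      refine LinearMap.ext fun z => funext fun j => ?_
      simp [Fintype.linearCombination_apply, isoCoord_isoProj hA])
    (by
      refine LinearMap.ext fun x => Subtype.ext ?_
      conv_rhs => rw [LinearMap.id_apply, ← isoProj_of_mem_self hA σ x.2, isoProj_eq_sum b]
      simp [Fintype.linearCombination_apply])

theorem finrank_isotypic [Fintype (L →+* A)] (hA : TraceSplits L A) [Module.Finite L U]
    (σ : L →+* A) : Module.finrank A (isotypic U σ) = Module.finrank L U := by
  rw [(isotypicEquiv hA (Module.finBasis L U) σ).finrank_eq, Module.finrank_pi,
    Fintype.card_fin]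

theorem traceSplits_complex [Fintype (L →+* ℂ)] : TraceSplits L ℂ := by
  intro x
  classical
  rw [trace_eq_sum_embeddings ℂ]
  exact Fintype.sum_equiv (RingHom.equivRatAlgHom (R := L) (S := ℂ)).symm _ _ fun _ => rfl

instance [IsTotallyReal L] : Finite (L →+* ℝ) :=
  Finite.of_injective (fun τ => Complex.ofRealHom.comp τ) fun τ τ' h => by
    ext x
    exact Complex.ofReal_injective (DFunLike.congr_fun h x)

/-- Every complex embedding of a totally real field factors through `ℝ`, so the complex trace
formula descends. -/
theorem traceSplits_real [IsTotallyReal L] [Fintype (L →+* ℝ)] : TraceSplits L ℝ := by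
  intro x
  apply Complex.ofReal_injective
  have h : (Complex.ofRealHom : ℝ → ℂ) (algebraMap ℚ ℝ (Algebra.trace ℚ L x)) =
      algebraMap ℚ ℂ (Algebra.trace ℚ L x) := by simp
  refine h.trans ?_
  rw [traceSplits_complex x, Complex.ofReal_sum]
  symm
  refine Fintype.sum_bijective (fun τ : L →+* ℝ => Complex.ofRealHom.comp τ) ⟨?_, ?_⟩ _ _
    fun τ => rfl
  · intro τ τ' h
    ext x
    exact Complex.ofReal_injective (DFunLike.congr_fun h x)
  · intro σ
    have hσ := IsTotallyReal.complexEmbedding_isReal σ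
    exact ⟨hσ.embedding, RingHom.ext fun y => hσ.coe_embedding_apply y⟩

end Isotypic

/-! ### Formulas for `η`, the pairing and the complex structure in terms of `Θ` -/

section Formulas
variable {F K M : Type*} [Field F] [NumberField F] [IsTotallyReal F] [Field K] [NumberField K]
  [IsTotallyComplex K] [Algebra F K] [Algebra.IsQuadraticExtension F K]
  [AddCommGroup M] [Module ℚ M] [Module F M] [Module.Finite ℚ M]
  {X : Torus F M} (Θ : Polarization X) (D : ImagGenerator F K)

theorem ImagGenerator.q_ne_zero : D.q ≠ 0 := by
  intro hq
  have := D.sq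
  rw [hq, map_zero, neg_zero] at this
  exact D.r_notMem 0 (by rw [map_zero]; exact (pow_eq_zero_iff two_ne_zero |>.mp this).symm)

/-- `η` is known only through its action on `W` and the conjugate. Applying `η_r = r` to the vectors
`m - r Θ(m, ·)` of `W` and comparing coefficients of `1` and `r` yields both off-diagonal blocks. -/
theorem eta_r_apply (v : V F M) :
    eta Θ D D.r v = (D.q • Θ.form v.2, -Θ.contract.symm v.1) := by
  have key : ∀ m : M, eta Θ D D.r (0, m) = D.q • ((Θ.form m, 0) : V F M) ∧
      eta Θ D D.r (Θ.form m, 0) = -((0, m) : V F M) := by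
    intro m
    have h := (eta_spec Θ D D.r _ (mem_W Θ D m)).1
    rw [map_sub, LinearMap.baseChange_tmul, LinearMap.baseChange_tmul, smul_sub,
      TensorProduct.smul_tmul', TensorProduct.smul_tmul', smul_eq_mul, smul_eq_mul, mul_one, ← sq,
      D.sq, TensorProduct.neg_tmul, sub_neg_eq_add] at h
    have c := fun i => congrArg (fun u =>
      TensorProduct.lid F (V F M) ((D.basis.coord i).rTensor (V F M) u)) h
    have c0 : D.basis.coord 0 1 = 1 ∧ D.basis.coord 1 1 = 0 := by
      rw [← D.basis_zero]; simp
    have c1 : D.basis.coord 0 D.r = 0 ∧ D.basis.coord 1 D.r = 1 := by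
      rw [← D.basis_one]; simp
    have cq : ∀ i, D.basis.coord i (algebraMap F K D.q) = D.q * D.basis.coord i 1 := by
      intro i
      rw [Algebra.algebraMap_eq_smul_one, map_smul, smul_eq_mul]
    constructor
    · have := c 0
      simpa only [map_sub, map_add, LinearMap.rTensor_tmul, TensorProduct.lid_tmul, cq, c0, c1,
        one_smul, zero_smul, sub_zero, zero_add, mul_one] using this
    · have := c 1
      simp only [map_sub, map_add, LinearMap.rTensor_tmul, TensorProduct.lid_tmul, cq, c0, c1,
        one_smul, zero_smul, zero_sub, add_zero, mul_zero] at this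
      rw [← this, neg_neg]
  obtain ⟨f, m⟩ := v
  obtain ⟨n, rfl⟩ := Θ.contract.surjective f
  have : ((Θ.contract n, m) : V F M) = (Θ.form n, 0) + (0, m) := by simp [Θ.contract_apply]
  rw [this, map_add, (key m).1, (key n).2]
  simp [← Θ.contract_apply]

variable (A : Type*) [Field A] [Algebra ℚ A]

/-- The inclusion of `H₁(X, A)` in `V_A` by `n ↦ (Θ(n, ·), 0)`. -/
def inT : A ⊗[ℚ] M →ₗ[A] VA F M A :=
  ((LinearMap.inl ℚ (Module.Dual F M) M) ∘ₗ (Θ.form).restrictScalars ℚ).baseChange A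

/-- The Riemann form over `A`. -/
abbrev psi : LinearMap.BilinForm A (A ⊗[ℚ] M) := (riemannForm Θ.form).baseChange A

variable {A}

@[simp] theorem inT_tmul (a : A) (n : M) : inT Θ A (a ⊗ₜ n) = a ⊗ₜ ((Θ.form n, 0) : V F M) := rfl

theorem mem_range_inH (n : A ⊗[ℚ] M) : ∃ h, inH F M A h = inT Θ A n :=
  ⟨((Θ.form).restrictScalars ℚ).baseChange A n, by
    induction n with
    | zero => simp
    | add x y hx hy => simp only [map_add, hx, hy]
    | tmul a n => rfl⟩

/-- Nondegeneracy of `Θ` supplies these coordinates `(n, m)` on `V_A`, in which `η`, the pairing and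
the complex structure are all expressed through `Θ`, `q` and `J`. -/
theorem exists_eq_inT_add_inM (x : VA F M A) : ∃ n m, x = inT Θ A n + inM F M A m := by
  induction x using TensorProduct.induction_on with
  | zero => exact ⟨0, 0, by simp⟩
  | add x y hx hy =>
    obtain ⟨n, m, rfl⟩ := hx
    obtain ⟨n', m', rfl⟩ := hy
    exact ⟨n + n', m + m', by simp only [map_add]; abel⟩
  | tmul a v =>
    obtain ⟨h, m⟩ := v
    refine ⟨a ⊗ₜ Θ.contract.symm h, a ⊗ₜ m, ?_⟩
    rw [inT_tmul, inM_tmul, ← TensorProduct.tmul_add, ← Θ.contract_apply]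
    simp

/-- Two bilinear forms on scalar extensions agree if they agree on the pure tensors. -/
theorem bilin_induction {U U' : Type*} [AddCommGroup U] [Module ℚ U] [AddCommGroup U'] [Module ℚ U']
    {B B' : A ⊗[ℚ] U →ₗ[A] A ⊗[ℚ] U' →ₗ[A] A} (h : ∀ u u', B (1 ⊗ₜ u) (1 ⊗ₜ u') = B' (1 ⊗ₜ u) (1 ⊗ₜ u'))
    (x y) : B x y = B' x y := by
  have e : ∀ (a : A) (u : U), a ⊗ₜ[ℚ] u = a • ((1 : A) ⊗ₜ[ℚ] u) := by
    intros; simp [TensorProduct.smul_tmul']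
  have e' : ∀ (a : A) (u : U'), a ⊗ₜ[ℚ] u = a • ((1 : A) ⊗ₜ[ℚ] u) := by
    intros; simp [TensorProduct.smul_tmul']
  induction x with
  | zero => simp
  | add x y hx hy => simp only [map_add, LinearMap.add_apply, hx, hy]
  | tmul a u =>
    induction y with
    | zero => simp
    | add x y hx hy => simp only [map_add, hx, hy]
    | tmul b u' => rw [e a u, e' b u']; simp only [map_smul, LinearMap.smul_apply, h]

theorem pairA_inT_inM (n m : A ⊗[ℚ] M) :
    pairA F M A (inT Θ A n) (inM F M A m) = psi Θ A n m :=
  bilin_induction (B := (pairA F M A).compl₁₂ (inT Θ A) (inM F M A)) (fun u u' => by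
    simp only [LinearMap.compl₁₂_apply, inT_tmul, inM_tmul, LinearMap.BilinForm.baseChange_tmul,
      Qpair_apply]
    simp [riemannForm]) n m

theorem pairA_inT_inT (n m : A ⊗[ℚ] M) : pairA F M A (inT Θ A n) (inT Θ A m) = 0 := by
  obtain ⟨h, hh⟩ := mem_range_inH Θ n
  obtain ⟨h', hh'⟩ := mem_range_inH Θ m
  rw [← hh, ← hh', pairA_inH_inH]

theorem psi_neg (n m : A ⊗[ℚ] M) : psi Θ A n m = -psi Θ A m n :=
  bilin_induction (B := psi Θ A) (B' := -(psi Θ A).flip) (fun u u' => by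
    simp only [LinearMap.neg_apply, LinearMap.BilinForm.baseChange_tmul]
    simp only [riemannForm, LinearMap.mk₂_apply]
    rw [← Θ.alt.neg]
    simp [riemannForm]) n m

theorem psi_actA (a : F) (n m : A ⊗[ℚ] M) : psi Θ A (actA A a n) m = psi Θ A n (actA A a m) :=
  bilin_induction (B := (psi Θ A).compl₁₂ (actA A a) LinearMap.id)
    (B' := (psi Θ A).compl₁₂ LinearMap.id (actA A a)) (fun u u' => by
    simp only [LinearMap.compl₁₂_apply, LinearMap.id_apply, actA_tmul,
      LinearMap.BilinForm.baseChange_tmul]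
    simp [riemannForm]) n m

theorem pairA_formula (n m n' m' : A ⊗[ℚ] M) :
    pairA F M A (inT Θ A n + inM F M A m) (inT Θ A n' + inM F M A m') =
      psi Θ A n m' + psi Θ A n' m := by
  rw [map_add, map_add, LinearMap.add_apply, LinearMap.add_apply, pairA_inT_inT, pairA_inT_inM,
    pairA_inM_inM, pairA_comm, pairA_inT_inM]
  ring

theorem etaA_tmul (t : K) (a : A) (v : V F M) : etaA Θ D A t (a ⊗ₜ v) = a ⊗ₜ eta Θ D t v := rfl

theorem etaA_mul (s t : K) : etaA Θ D A (s * t) = etaA Θ D A s * etaA Θ D A t := by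
  refine LinearMap.ext fun x => ?_
  induction x using TensorProduct.induction_on with
  | zero => simp
  | add x y hx hy => rw [map_add, map_add, hx, hy]
  | tmul a v => simp [etaA_tmul]

theorem etaA_add (s t : K) : etaA Θ D A (s + t) = etaA Θ D A s + etaA Θ D A t := by
  refine LinearMap.ext fun x => ?_
  induction x using TensorProduct.induction_on with
  | zero => simp
  | add x y hx hy => rw [map_add, map_add, hx, hy]
  | tmul a v => simp [etaA_tmul, TensorProduct.tmul_add]

theorem etaA_algebraMap_inM (a : F) (m : A ⊗[ℚ] M) :
    etaA Θ D A (algebraMap F K a) (inM F M A m) = inM F M A (actA A a m) := by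
  induction m with
  | zero => simp
  | add x y hx hy => simp only [map_add, hx, hy]
  | tmul z m => simp [etaA_tmul]

theorem etaA_algebraMap_inT (a : F) (n : A ⊗[ℚ] M) :
    etaA Θ D A (algebraMap F K a) (inT Θ A n) = inT Θ A (actA A a n) := by
  induction n with
  | zero => simp
  | add x y hx hy => simp only [map_add, hx, hy]
  | tmul z m => simp [etaA_tmul]

theorem etaA_r_inM (m : A ⊗[ℚ] M) :
    etaA Θ D A D.r (inM F M A m) = inT Θ A (actA A D.q m) := by
  induction m with
  | zero => simp
  | add x y hx hy => simp only [map_add, hx, hy]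
  | tmul z m => simp [etaA_tmul, eta_r_apply]

theorem etaA_r_inT (n : A ⊗[ℚ] M) :
    etaA Θ D A D.r (inT Θ A n) = -inM F M A n := by
  induction n with
  | zero => simp
  | add x y hx hy => simp only [map_add, hx, hy, neg_add]
  | tmul z m => simp [etaA_tmul, eta_r_apply, ← Θ.contract_apply, ← TensorProduct.tmul_neg]

theorem etaA_coords (a b : F) (n m : A ⊗[ℚ] M) :
    etaA Θ D A (algebraMap F K a + algebraMap F K b * D.r) (inT Θ A n + inM F M A m) =
      inT Θ A (actA A a n + actA A b (actA A D.q m)) + inM F M A (actA A a m - actA A b n) := by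
  rw [etaA_add, etaA_mul, LinearMap.add_apply, Module.End.mul_apply, map_add, map_add, etaA_r_inM,
    etaA_r_inT, map_add, map_neg]
  simp only [etaA_algebraMap_inM, etaA_algebraMap_inT, map_add, map_sub]
  abel

theorem actA_comm (a b : F) (x : A ⊗[ℚ] M) :
    actA A a (actA A b x) = actA A b (actA A a x) := by
  rw [← Module.End.mul_apply, ← actA_mul, mul_comm, actA_mul, Module.End.mul_apply]

/-- `η_{ι(s)}` is the adjoint of `η_s` for the pairing. -/
theorem pairA_etaA (s : K) (x y : VA F M A) :
    pairA F M A (etaA Θ D A s x) y = pairA F M A x (etaA Θ D A (iota F K s) y) := by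
  obtain ⟨n, m, rfl⟩ := exists_eq_inT_add_inM Θ x
  obtain ⟨n', m', rfl⟩ := exists_eq_inT_add_inM Θ y
  obtain ⟨a, b, rfl⟩ := D.exists_coords s
  have h : iota F K (algebraMap F K a + algebraMap F K b * D.r) =
      algebraMap F K a + algebraMap F K (-b) * D.r := by
    simp [D.iota_r]
  have hb : ∀ x : A ⊗[ℚ] M, actA A (-b) x = -actA A b x := by
    intro x
    have := actA_add A (U := M) b (-b)
    rw [add_neg_cancel] at this
    have h0 : actA A (U := M) (0 : F) = 0 := (actAHom A M).map_zero
    rw [h0] at this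
    rw [eq_neg_iff_add_eq_zero, add_comm, ← LinearMap.add_apply, ← this, LinearMap.zero_apply]
  rw [h, etaA_coords, etaA_coords, pairA_formula, pairA_formula]
  simp only [hb, map_add, map_sub, map_neg, LinearMap.add_apply, LinearMap.neg_apply,
    psi_actA]
  rw [psi_neg Θ n' (actA A b n), psi_actA, psi_neg Θ m', psi_actA, psi_actA, actA_comm]
  ring

end Formulas

/-! ### The complex structure and positivity in the coordinates `(n, m)` -/

section RealFormulas
variable {F K M : Type*} [Field F] [NumberField F] [IsTotallyReal F] [Field K] [NumberField K]
  [IsTotallyComplex K] [Algebra F K] [Algebra.IsQuadraticExtension F K]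
  [AddCommGroup M] [Module ℚ M] [Module F M] [Module.Finite ℚ M]
  {X : Torus F M} (Θ : Polarization X) (D : ImagGenerator F K)

theorem realDual_apply (h : ℝ ⊗[ℚ] Module.Dual F M) (m : ℝ ⊗[ℚ] M) :
    realDual F M h m = pairA F M ℝ (inH F M ℝ h) (inM F M ℝ m) :=
  bilin_induction (B := (realDual F M).toLinearMap)
    (B' := (pairA F M ℝ).compl₁₂ (inH F M ℝ) (inM F M ℝ)) (fun u u' => by
      simp only [LinearMap.compl₁₂_apply, inH_tmul, inM_tmul, LinearMap.BilinForm.baseChange_tmul,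
        Qpair_apply]
      refine ((TensorProduct.isBaseChange ℚ M ℝ).toDualBaseChange_tmul 1 (traceDual F M u) u').trans ?_
      simp) h m

theorem prodDualJ_inM (m : ℝ ⊗[ℚ] M) :
    X.prodDualJ (inM F M ℝ m) = -inM F M ℝ (X.J m) := by
  have e : ∀ m, TensorProduct.prodRight ℚ ℝ ℝ (Module.Dual F M) M (inM F M ℝ m) = (0, m) := by
    intro m
    induction m with
    | zero => simp only [map_zero]; rfl
    | add x y hx hy => rw [map_add, map_add, hx, hy]; simp
    | tmul a m => simp
  rw [Torus.prodDualJ, LinearEquiv.conj_apply_apply, LinearEquiv.symm_symm, LinearEquiv.symm_apply_eq, e,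
    map_neg, e]
  simp

theorem prodDualJ_inH (h : ℝ ⊗[ℚ] Module.Dual F M) :
    X.prodDualJ (inH F M ℝ h) = inH F M ℝ (X.cohJ h) := by
  have e : ∀ h, TensorProduct.prodRight ℚ ℝ ℝ (Module.Dual F M) M (inH F M ℝ h) = (h, 0) := by
    intro h
    induction h with
    | zero => simp only [map_zero]; rfl
    | add x y hx hy => rw [map_add, map_add, hx, hy]; simp
    | tmul a m => simp
  rw [Torus.prodDualJ, LinearEquiv.conj_apply_apply, LinearEquiv.symm_symm, LinearEquiv.symm_apply_eq, e, e]
  simp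

theorem realDual_cohJ (h : ℝ ⊗[ℚ] Module.Dual F M) :
    realDual F M (X.cohJ h) = realDual F M h ∘ₗ X.J := by
  rw [Torus.cohJ, LinearEquiv.conj_apply_apply, LinearEquiv.apply_symm_apply]
  rfl

theorem J_J (m : ℝ ⊗[ℚ] M) : X.J (X.J m) = -m := by
  rw [← Module.End.mul_apply, X.J_mul_J]; rfl

theorem psi_J (n m : ℝ ⊗[ℚ] M) : psi Θ ℝ (X.J n) m = -psi Θ ℝ n (X.J m) := by
  have := Θ.invariant n (X.J m)
  rw [J_J, map_neg] at this
  rw [← this, neg_neg]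

/-- Since `ψ` is of type `(1,1)`, `J` is skew for it, so precomposing `ψ(n, ·)` with `J` gives
`-ψ(Jn, ·)`. This matches the action `-J` on the other summand. -/
theorem prodDualJ_inT (n : ℝ ⊗[ℚ] M) :
    X.prodDualJ (inT Θ ℝ n) = -inT Θ ℝ (X.J n) := by
  obtain ⟨h, hh⟩ := mem_range_inH Θ n
  obtain ⟨h', hh'⟩ := mem_range_inH Θ (X.J n)
  rw [← hh, ← hh', prodDualJ_inH, ← map_neg]
  congr 1
  apply (realDual F M).injective
  rw [realDual_cohJ]
  ext m
  rw [map_neg]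
  change realDual F M h (X.J _) = - realDual F M h' _
  rw [realDual_apply, realDual_apply, hh, hh', pairA_inT_inM, pairA_inT_inM, psi_J, neg_neg]

theorem prodDualJ_formula (n m : ℝ ⊗[ℚ] M) : X.prodDualJ (inT Θ ℝ n + inM F M ℝ m) =
    inT Θ ℝ (-X.J n) + inM F M ℝ (-X.J m) := by
  rw [map_add, prodDualJ_inT, prodDualJ_inM, map_neg, map_neg]

theorem J_actA (a : F) (m : ℝ ⊗[ℚ] M) : X.J (actA ℝ a m) = actA ℝ a (X.J m) :=
  DFunLike.congr_fun (X.J_comm a) m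

include Θ in
theorem prodDualJ_mul_self : X.prodDualJ * X.prodDualJ = (-1 : Module.End ℝ (VA F M ℝ)) := by
  refine LinearMap.ext fun x => ?_
  obtain ⟨n, m, rfl⟩ := exists_eq_inT_add_inM Θ x
  rw [Module.End.mul_apply, prodDualJ_formula, prodDualJ_formula]
  simp [J_J]
  abel

theorem commute_prodDualJ_etaA (s : K) : Commute X.prodDualJ (etaA Θ D ℝ s) := by
  refine LinearMap.ext fun x => ?_
  obtain ⟨n, m, rfl⟩ := exists_eq_inT_add_inM Θ x
  obtain ⟨a, b, rfl⟩ := D.exists_coords s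
  rw [Module.End.mul_apply, Module.End.mul_apply, prodDualJ_formula, etaA_coords, etaA_coords,
    prodDualJ_formula]
  simp only [map_add, map_sub, map_neg, J_actA]
  abel

/-- `η_r` interchanges the two isotropic summands, and the pairing interchanges them back, so no
cross terms remain. -/
theorem Xi_formula (n m n' m' : ℝ ⊗[ℚ] M) :
    Xi Θ D D.r (inT Θ ℝ n + inM F M ℝ m) (inT Θ ℝ n' + inM F M ℝ m') =
      psi Θ ℝ (actA ℝ D.q m) m' + psi Θ ℝ n n' := by
  rw [Xi, LinearMap.BilinForm.compLeft_apply, map_add (etaA _ _ _ _), etaA_r_inM, etaA_r_inT, add_comm (-_),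
    ← map_neg, pairA_formula, map_neg, psi_neg Θ n' n, neg_neg]

theorem Xi_adjoint (s : K) (x y : VA F M ℝ) :
    Xi Θ D D.r (etaA Θ D ℝ s x) y = Xi Θ D D.r x (etaA Θ D ℝ (iota F K s) y) := by
  rw [Xi, LinearMap.BilinForm.compLeft_apply, LinearMap.BilinForm.compLeft_apply, ← pairA_etaA,
    ← Module.End.mul_apply, ← Module.End.mul_apply, ← etaA_mul, ← etaA_mul, mul_comm]

theorem Xi_neg (x y : VA F M ℝ) : Xi Θ D D.r x y = -Xi Θ D D.r y x := by
  obtain ⟨n, m, rfl⟩ := exists_eq_inT_add_inM Θ x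
  obtain ⟨n', m', rfl⟩ := exists_eq_inT_add_inM Θ y
  rw [Xi_formula, Xi_formula, psi_neg Θ n n', psi_neg Θ _ m', psi_actA]
  ring

theorem Xi_isAlt : (Xi Θ D D.r).IsAlt := by
  intro x
  have := Xi_neg Θ D x x
  linarith

theorem Xi_invariant (x y : VA F M ℝ) :
    Xi Θ D D.r (X.prodDualJ x) (X.prodDualJ y) = Xi Θ D D.r x y := by
  obtain ⟨n, m, rfl⟩ := exists_eq_inT_add_inM Θ x
  obtain ⟨n', m', rfl⟩ := exists_eq_inT_add_inM Θ y
  rw [prodDualJ_formula, prodDualJ_formula, Xi_formula, Xi_formula]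
  simp only [map_neg, LinearMap.neg_apply, neg_neg, ← J_actA, Θ.invariant]

theorem Xi_symm (x y : VA F M ℝ) :
    Xi Θ D D.r x (X.prodDualJ y) = Xi Θ D D.r y (X.prodDualJ x) := by
  rw [← Xi_invariant Θ D, ← Module.End.mul_apply X.prodDualJ X.prodDualJ, prodDualJ_mul_self Θ,
    LinearMap.neg_apply, Module.End.one_apply, map_neg, ← Xi_neg]

/-- Every embedding of `F` in `ℝ` extends to an embedding of `K` in `ℂ`. -/
theorem exists_extension (K : Type*) [Field K] [NumberField K] [Algebra F K]
    [Algebra.IsQuadraticExtension F K] (τ : F →+* ℝ) :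
    ∃ σ : K →+* ℂ, ∀ a, σ (algebraMap F K a) = (τ a : ℂ) := by
  let : Algebra F ℂ := (Complex.ofRealHom.comp τ).toAlgebra
  have : Algebra.IsAlgebraic F K := Algebra.IsAlgebraic.of_finite F K
  exact ⟨(IsAlgClosed.lift : K →ₐ[F] ℂ), fun a =>
    AlgHom.commutes (IsAlgClosed.lift : K →ₐ[F] ℂ) a⟩

/-- Complex conjugation induces `ι`, which negates `r`. Hence `r` has a purely imaginary image, and
`q = -r²` maps to the square of its imaginary part. -/
theorem embedding_q_pos (τ : F →+* ℝ) : 0 < τ D.q := by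
  obtain ⟨σ, hσ⟩ := exists_extension K τ
  have h1 : (starRingEnd ℂ) (σ D.r) = -σ D.r := by
    rw [← embedding_iota F K, D.iota_r, map_neg]
  have h2 : (σ D.r).re = 0 := by
    have := congrArg Complex.re h1
    simp at this
    linarith
  have h3 : τ D.q = (σ D.r).im ^ 2 := by
    have h := congrArg (fun k => (σ k).re) D.sq
    simp only [map_neg, map_pow, hσ] at h
    simp [sq, h2] at h
    rw [sq]; linarith
  have h4 : τ D.q ≠ 0 := (map_ne_zero τ).mpr D.q_ne_zero
  rw [h3] at h4 ⊢
  positivity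

/-- `F` acts self-adjointly for `ψ` and commutes with `J`, so eigenspaces of distinct characters are
orthogonal. -/
theorem psi_J_isotypic {σ τ : F →+* ℝ} (h : σ ≠ τ) {x y : ℝ ⊗[ℚ] M} (hx : x ∈ isotypic M σ)
    (hy : y ∈ isotypic M τ) : psi Θ ℝ (X.J x) y = 0 := by
  rw [mem_isotypic] at hx hy
  obtain ⟨a, ha⟩ := DFunLike.ne_iff.mp h
  have := psi_actA Θ a (X.J x) y
  rw [← J_actA, hx, hy] at this
  simp only [map_smul, LinearMap.smul_apply, smul_eq_mul] at this
  rw [← sub_eq_zero, ← sub_mul] at this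
  exact (mul_eq_zero.mp this).resolve_left (sub_ne_zero.mpr ha)

theorem psi_J_nonneg (x : ℝ ⊗[ℚ] M) : 0 ≤ psi Θ ℝ (X.J x) x := by
  by_cases h : x = 0
  · simp [h]
  · exact (Θ.pos x h).le

/-- The Riemann form stays positive after twisting by the totally positive element `q`. -/
theorem psi_J_q_pos (m : ℝ ⊗[ℚ] M) (hm : m ≠ 0) : 0 < psi Θ ℝ (X.J m) (actA ℝ D.q m) := by
  have : Fintype (F →+* ℝ) := Fintype.ofFinite _
  have hsum := sum_isoProj (U := M) (traceSplits_real (L := F)) m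
  -- On the eigenspace of `τ` the twist by `q` is multiplication by the positive number `τ q`, and
  -- the cross terms vanish.
  have h1 : psi Θ ℝ (X.J m) (actA ℝ D.q m) =
      ∑ τ : F →+* ℝ, τ D.q * psi Θ ℝ (X.J (isoProj M τ m)) (isoProj M τ m) := by
    conv_lhs => rw [← hsum]
    simp only [map_sum, LinearMap.sum_apply]
    refine Finset.sum_congr rfl fun τ _ => ?_
    rw [Finset.sum_eq_single τ]
    · rw [mem_isotypic.mp (isoProj_mem τ m), map_smul, smul_eq_mul]
    · intro σ _ hσ
      rw [mem_isotypic.mp (isoProj_mem _ m), map_smul]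
      rw [psi_J_isotypic Θ hσ (isoProj_mem _ m) (isoProj_mem _ m), smul_zero]
    · simp
  rw [h1]
  obtain ⟨τ, hτ⟩ : ∃ τ : F →+* ℝ, isoProj M τ m ≠ 0 := by
    by_contra! h
    apply hm
    rw [← hsum]
    exact Finset.sum_eq_zero fun τ _ => h τ
  exact Finset.sum_pos' (fun τ _ => mul_nonneg (embedding_q_pos D τ).le (psi_J_nonneg Θ _))
    ⟨τ, Finset.mem_univ _, mul_pos (embedding_q_pos D τ) (Θ.pos _ hτ)⟩

theorem Xi_pos (x : VA F M ℝ) (hx : x ≠ 0) : 0 < Xi Θ D D.r x (X.prodDualJ x) := by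
  obtain ⟨n, m, rfl⟩ := exists_eq_inT_add_inM Θ x
  rw [prodDualJ_formula, Xi_formula, map_neg, map_neg, psi_neg Θ _ (X.J m), psi_neg Θ n, neg_neg,
    neg_neg]
  by_cases hm : m = 0
  · have hn : n ≠ 0 := by
      rintro rfl
      simp [hm] at hx
    rw [hm]
    simpa using Θ.pos n hn
  · exact add_pos_of_pos_of_nonneg (psi_J_q_pos Θ D m hm) (psi_J_nonneg Θ n)

end RealFormulas

section Period
variable {F K M : Type*} [Field F] [NumberField F] [IsTotallyReal F] [Field K] [NumberField K]
  [IsTotallyComplex K] [Algebra F K] [Algebra.IsQuadraticExtension F K]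
  [AddCommGroup M] [Module ℚ M] [Module F M] [Module.Finite ℚ M]
  {X : Torus F M} (Θ : Polarization X) (D : ImagGenerator F K)

/-! ### The complex structure preserves `W_T` -/

theorem complexify_mem_Vsigma {σ : K →+* ℂ} {x : VA F M ℂ} (hx : x ∈ Vsigma Θ D σ) :
    complexify X.prodDualJ x ∈ Vsigma Θ D σ := by
  simp only [Vsigma, Submodule.mem_iInf, Module.End.mem_eigenspace_iff] at hx ⊢
  intro t
  have h : etaA Θ D ℂ t = complexify (etaA Θ D ℝ t) := (complexify_baseChange _).symm
  rw [h, ← Module.End.mul_apply, ← complexify_mul, ← (commute_prodDualJ_etaA Θ D t).eq,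
    complexify_mul, Module.End.mul_apply, ← h, hx, map_smul]

include Θ in
theorem complexify_prodDualJ_sq (x : VA F M ℂ) :
    complexify X.prodDualJ (complexify X.prodDualJ x) = -x := by
  rw [← Module.End.mul_apply, ← complexify_mul, prodDualJ_mul_self Θ, complexify_neg,
    complexify_one]
  rfl

theorem complexify_mem_WT {T : CMType F K} {x : VA F M ℂ} (hx : x ∈ WT Θ D T) :
    complexify X.prodDualJ x ∈ WT Θ D T := by
  have : WT Θ D T ≤ (WT Θ D T).comap (complexify X.prodDualJ) :=
    iSup_le fun τ y hy => le_iSup (fun τ => Vsigma Θ D (T.toFun τ)) τ (complexify_mem_Vsigma Θ D hy)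
  exact this hx

/-- The part of `V_{σ,ℂ}` above an isotypic vector of `H₁(X, ℂ)`. -/
theorem graph_mem_Vsigma (σ : K →+* ℂ) {m : ℂ ⊗[ℚ] M}
    (hm : m ∈ isotypic M (σ.comp (algebraMap F K))) :
    (σ D.r)⁻¹ • etaA Θ D ℂ D.r (inM F M ℂ m) + inM F M ℂ m ∈ Vsigma Θ D σ := by
  have hr : D.r ≠ 0 := fun h => D.r_notMem 0 (by rw [map_zero, h])
  have hs : σ D.r ≠ 0 := (map_ne_zero σ).mpr hr
  rw [mem_isotypic] at hm
  have hq : ∀ b : F, etaA Θ D ℂ (algebraMap F K b) (inM F M ℂ m) = σ (algebraMap F K b) • inM F M ℂ m := by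
    intro b
    rw [etaA_algebraMap_inM, hm, map_smul]
    rfl
  set w := (σ D.r)⁻¹ • etaA Θ D ℂ D.r (inM F M ℂ m) + inM F M ℂ m with hw
  have hF : ∀ a : F, etaA Θ D ℂ (algebraMap F K a) w = σ (algebraMap F K a) • w := by
    intro a
    rw [hw, map_add, map_smul, ← Module.End.mul_apply, ← etaA_mul, mul_comm, etaA_mul,
      Module.End.mul_apply, hq, map_smul, smul_add, smul_comm]
  -- On the `F`-isotypic part `η_r²` is the scalar `σ(r)²`, so `1 + σ(r)⁻¹ η_r` maps into the
  -- eigenspace of `η_r` for `σ(r)`.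
  have hR : etaA Θ D ℂ D.r w = σ D.r • w := by
    rw [hw, map_add, map_smul, ← Module.End.mul_apply, ← etaA_mul, ← sq, D.sq, ← map_neg, hq,
      map_neg, ← D.sq, smul_add, smul_smul, smul_smul, mul_inv_cancel₀ hs, one_smul, map_pow, sq,
      inv_mul_cancel_left₀ hs, add_comm]
  simp only [Vsigma, Submodule.mem_iInf, Module.End.mem_eigenspace_iff]
  intro t
  obtain ⟨a, b, rfl⟩ := D.exists_coords t
  rw [etaA_add, etaA_mul, LinearMap.add_apply, Module.End.mul_apply, hR, map_smul, hF, hF, map_add,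
    map_mul, add_smul, mul_smul, smul_comm]

/-- Decompose `m` under the embeddings of `F`. Each of them is real, so `T` extends it to `K`, and
the corresponding `V_{σ,ℂ}` contains a vector above that component. -/
theorem exists_graph_mem_WT (T : CMType F K) (m : ℂ ⊗[ℚ] M) :
    ∃ h, inH F M ℂ h + inM F M ℂ m ∈ WT Θ D T := by
  have hex : ∀ σ : F →+* ℂ, ∃ h, inH F M ℂ h + inM F M ℂ (isoProj M σ m) ∈ WT Θ D T := by
    intro σ
    have hσ := IsTotallyReal.complexEmbedding_isReal σ
    have e : (T.toFun hσ.embedding).comp (algebraMap F K) = σ := by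
      ext a
      rw [RingHom.comp_apply, T.extends_self, hσ.coe_embedding_apply]
    have h1 := graph_mem_Vsigma Θ D (T.toFun hσ.embedding) (m := isoProj M σ m)
      (by rw [e]; exact isoProj_mem σ m)
    rw [etaA_r_inM, ← map_smul] at h1
    obtain ⟨h, hh⟩ := mem_range_inH Θ ((T.toFun hσ.embedding D.r)⁻¹ • actA ℂ D.q (isoProj M σ m))
    rw [← hh] at h1
    exact ⟨h, le_iSup (fun τ => Vsigma Θ D (T.toFun τ)) hσ.embedding h1⟩
  choose h hh using hex
  refine ⟨∑ σ, h σ, ?_⟩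
  have := sum_mem (t := Finset.univ) fun σ _ => hh σ
  rwa [Finset.sum_add_distrib, ← map_sum, ← map_sum, sum_isoProj traceSplits_complex] at this

/-! ### The complex structure lifts to the spin group -/

variable (F M) in
/-- The polarization of `V_ℝ` given by `H¹(X, ℝ)` and `H₁(X, ℝ)`, with the spin representation. -/
def realPolarizedRep : PolarizedRep (ℝ ⊗[ℚ] M) (ℝ ⊗[ℚ] S F M) (QA F M ℝ) where
  inl := inH F M ℝ ∘ₗ (realDual F M).symm.toLinearMap
  inr := inM F M ℝ
  inl_isotropic _ := QA_inH _
  inr_isotropic _ := QA_inM _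
  polar_inl_inr h m := by
    rw [polar_QA, LinearMap.comp_apply, ← realDual_apply, LinearEquiv.coe_coe,
      LinearEquiv.apply_symm_apply]
  rep := spinRepA F M ℝ
  vac := vac F M ℝ
  vac_inl _ _ := vac_cl_inH _ _

/-- `-J` is the square of `(1 - J)/√2`, so its determinant is nonnegative. Its squared determinant
is `det(-1) = ±1`, and a real square is not `-1`. -/
theorem det_neg_J (X : Torus F M) : LinearMap.det (-X.J) = 1 := by
  have h2 : Real.sqrt 2 * Real.sqrt 2 = 2 := Real.mul_self_sqrt (by norm_num)
  have h0 : Real.sqrt 2 ≠ 0 := by positivity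
  have hR : -X.J = ((Real.sqrt 2)⁻¹ • (1 - X.J)) * ((Real.sqrt 2)⁻¹ • (1 - X.J)) := by
    have : (1 - X.J) * (1 - X.J) = (2 : ℝ) • -X.J := by
      refine LinearMap.ext fun x => ?_
      simp [J_J, two_smul]; abel
    rw [smul_mul_smul_comm, this, smul_smul, ← mul_inv, h2]
    norm_num
  have hnn : 0 ≤ LinearMap.det (-X.J) := by
    rw [hR, map_mul]; exact mul_self_nonneg _
  have hsq : LinearMap.det (-X.J) * LinearMap.det (-X.J) = 1 := by
    have h1 : LinearMap.det (-X.J) * LinearMap.det (-X.J) =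
        (-1) ^ Module.finrank ℝ (ℝ ⊗[ℚ] M) := by
      have hJ : (-X.J) * (-X.J) = -1 := LinearMap.ext fun x => by simp [J_J]
      rw [← map_mul, hJ]
      have h3 : (-1 : Module.End ℝ (ℝ ⊗[ℚ] M)) = (-1 : ℝ) • 1 :=
        LinearMap.ext fun x => by simp
      rw [h3, LinearMap.det_smul, map_one, mul_one]
    rcases neg_one_pow_eq_or ℝ (Module.finrank ℝ (ℝ ⊗[ℚ] M)) with h | h
    · rw [h1, h]
    · have := mul_self_nonneg (LinearMap.det (-X.J))
      rw [h1, h] at this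
      norm_num at this
  nlinarith

/-- Lift `-J ∈ GL(H₁(X, ℝ))`. Determinant one gives both spinor norm one and invariance of the
degree-zero component, which is what fixing `B` requires. -/
theorem prodDualJ_mem_rhoSpinB : X.prodDualJ ∈ rhoSpinB Θ D := by
  have hdet := det_neg_J X
  obtain ⟨g, hl, he, hs, hs', hm, hh, hv⟩ :=
    (realPolarizedRep F M).hasLift (-X.J) (by rw [hdet]; exact one_ne_zero)
  rw [hdet, map_one] at hs hs'
  simp only [hdet, one_mul] at hv
  have hcov : ∀ v, (g : CliffordAlgebra (QA F M ℝ)) * CliffordAlgebra.ι (QA F M ℝ) v =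
      CliffordAlgebra.ι (QA F M ℝ) (X.prodDualJ v) * g := by
    intro v
    obtain ⟨n, m, rfl⟩ := exists_eq_inT_add_inM Θ v
    obtain ⟨h, e⟩ := mem_range_inH Θ n
    rw [← e, map_add, map_add, map_add, mul_add, add_mul, prodDualJ_inH, prodDualJ_inM, ← map_neg]
    refine congrArg₂ (· + ·) ?_ (hm m)
    have h1 := hh (realDual F M (X.cohJ h))
    -- On linear forms the lift acts by the inverse transpose of `-J`, which is the transpose of `J`
    -- because `J² = -1`.
    have h2 : realDual F M (X.cohJ h) ∘ₗ (-X.J) = realDual F M h := by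
      ext x
      rw [realDual_cohJ]
      change realDual F M h (X.J (-X.J _)) = realDual F M h _
      rw [map_neg, J_J, neg_neg]
    rw [h2] at h1
    simpa [PolarizedRep.X, realPolarizedRep] using h1
  refine ⟨g, ⟨⟨⟨g, hl, rfl⟩, Unitary.mem_iff.mpr ⟨hs, hs'⟩⟩, he⟩, fun b hb => ?_, fun v => ?_⟩
  · refine fixes_B Θ D (f := X.prodDualJ) ?_ hv (fun T w hw => ?_) (exists_graph_mem_WT Θ D) hb
    · intro v s
      have := congrArg (fun x => spinRepA F M ℝ x s) (hcov v)
      simp only [map_mul] at this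
      exact this
    · exact ⟨-complexify X.prodDualJ w, neg_mem (complexify_mem_WT Θ D hw), by
        rw [map_neg, complexify_prodDualJ_sq Θ, neg_neg]⟩
  · rw [hcov, mul_assoc, hs', mul_one]

end Period

/-! ### The signature of the complex structure -/

section Signature
variable {F K M : Type*} [Field F] [NumberField F] [IsTotallyReal F] [Field K] [NumberField K]
  [IsTotallyComplex K] [Algebra F K] [Algebra.IsQuadraticExtension F K]
  [AddCommGroup M] [Module ℚ M] [Module F M] [Module.Finite ℚ M]
  {X : Torus F M} (Θ : Polarization X) (D : ImagGenerator F K)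

instance : Module F (Veta Θ D) := inferInstanceAs (Module F (V F M))

instance : Module ℚ (Veta Θ D) := inferInstanceAs (Module ℚ (V F M))

instance : IsScalarTower F K (Veta Θ D) where
  smul_assoc a k v := DFunLike.congr_fun (map_smul (eta Θ D) a k) (v : V F M)

instance : Module.Finite F (Veta Θ D) :=
  have : Module.Finite F M := Module.Finite.of_restrictScalars_finite ℚ F M
  inferInstanceAs (Module.Finite F (V F M))

instance : Module.Finite K (Veta Θ D) := Module.Finite.of_restrictScalars_finite F K _

theorem finrank_Veta : Module.finrank K (Veta Θ D) = Module.finrank F M := by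
  have : Module.Finite F M := Module.Finite.of_restrictScalars_finite ℚ F M
  have h1 := Module.finrank_mul_finrank F K (Veta Θ D)
  have h2 : Module.finrank F (Veta Θ D) = Module.finrank F (V F M) := rfl
  rw [h2, Module.finrank_prod, Subspace.dual_finrank_eq, Algebra.IsQuadraticExtension.finrank_eq_two]
    at h1
  omega

/-- `V_{σ,ℂ}` is by definition the isotypic part for `σ` of the `K`-vector space `V_η`, so its
dimension is `dim_K V_η`. -/
theorem finrank_Vsigma (σ : K →+* ℂ) :
    Module.finrank ℂ (Vsigma Θ D σ) = Module.finrank F M := by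
  rw [← finrank_Veta Θ D, ← finrank_isotypic traceSplits_complex σ]
  rfl

variable (F M) in
/-- The map `(h, m) ↦ (-h, m)`. -/
def flipH : Module.End ℚ (V F M) := LinearMap.prodMap (-LinearMap.id) LinearMap.id

variable (F M) in
/-- The antilinear extension of `(h, m) ↦ (-h, m)` to `V_ℂ`. -/
def conjFlip : VA F M ℂ →ₗ[ℝ] VA F M ℂ :=
  TensorProduct.AlgebraTensorModule.map Complex.conjAe.toLinearMap (flipH F M)

theorem conjFlip_tmul (z : ℂ) (v : V F M) :
    conjFlip F M (z ⊗ₜ v) = (starRingEnd ℂ) z ⊗ₜ flipH F M v := rfl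

theorem conjFlip_smul (z : ℂ) (x : VA F M ℂ) :
    conjFlip F M (z • x) = (starRingEnd ℂ) z • conjFlip F M x := by
  induction x using TensorProduct.induction_on with
  | zero => simp
  | add x y hx hy => rw [smul_add, map_add, map_add, hx, hy, smul_add]
  | tmul a v => simp [TensorProduct.smul_tmul', conjFlip_tmul]

theorem conjFlip_conjFlip (x : VA F M ℂ) : conjFlip F M (conjFlip F M x) = x := by
  induction x using TensorProduct.induction_on with
  | zero => simp
  | add x y hx hy => rw [map_add, map_add, hx, hy]
  | tmul a v => simp [conjFlip_tmul, flipH]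

/-- Changing the sign on `H¹(X)` negates both off-diagonal blocks of `η_r`, turning it into
`η_{-r}`; equivalently, the flip exchanges `W` and its conjugate. -/
theorem eta_flipH (t : K) (v : V F M) :
    eta Θ D (iota F K t) (flipH F M v) = flipH F M (eta Θ D t v) := by
  obtain ⟨a, b, rfl⟩ := D.exists_coords t
  obtain ⟨h, m⟩ := v
  simp [D.iota_r, eta_r_apply, flipH]
  abel

theorem etaA_conjFlip (t : K) (x : VA F M ℂ) :
    etaA Θ D ℂ (iota F K t) (conjFlip F M x) = conjFlip F M (etaA Θ D ℂ t x) := by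
  induction x using TensorProduct.induction_on with
  | zero => simp
  | add x y hx hy => simp only [map_add, hx, hy]
  | tmul a v => rw [conjFlip_tmul, etaA_tmul, etaA_tmul, conjFlip_tmul, eta_flipH]

/-- The flip replaces `t` by `ι t` and antilinearity conjugates the eigenvalue. The two effects
cancel, as `σ ∘ ι` is the conjugate of `σ`. -/
theorem conjFlip_mem_Vsigma {σ : K →+* ℂ} {x : VA F M ℂ} (hx : x ∈ Vsigma Θ D σ) :
    conjFlip F M x ∈ Vsigma Θ D σ := by
  simp only [Vsigma, Submodule.mem_iInf, Module.End.mem_eigenspace_iff] at hx ⊢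
  intro t
  have h : iota F K (iota F K t) = t := by
    obtain ⟨a, b, rfl⟩ := D.exists_coords t
    simp [D.iota_r]
  rw [← h, etaA_conjFlip, hx, conjFlip_smul, ← embedding_iota F K]

theorem conjFlip_inclC (x : VA F M ℝ) :
    conjFlip F M (inclC (V F M) x) = inclC (V F M) ((flipH F M).baseChange ℝ x) := by
  induction x using TensorProduct.induction_on with
  | zero => simp
  | add x y hx hy => simp only [map_add, hx, hy]
  | tmul a v =>
    rw [inclC_tmul, conjFlip_tmul, LinearMap.baseChange_tmul, inclC_tmul, Complex.conj_ofReal]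

theorem flipH_inT (n : ℝ ⊗[ℚ] M) : (flipH F M).baseChange ℝ (inT Θ ℝ n) = -inT Θ ℝ n := by
  induction n with
  | zero => simp
  | add x y hx hy => simp only [map_add, hx, hy, neg_add]
  | tmul a v => simp [flipH, ← TensorProduct.tmul_neg]

theorem flipH_inM (n : ℝ ⊗[ℚ] M) : (flipH F M).baseChange ℝ (inM F M ℝ n) = inM F M ℝ n := by
  induction n with
  | zero => simp
  | add x y hx hy => simp only [map_add, hx, hy]
  | tmul a v => simp [flipH]

include Θ in
theorem prodDualJ_flipH (x : VA F M ℝ) :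
    X.prodDualJ ((flipH F M).baseChange ℝ x) = (flipH F M).baseChange ℝ (X.prodDualJ x) := by
  obtain ⟨n, m, rfl⟩ := exists_eq_inT_add_inM Θ x
  simp only [map_add, flipH_inT, flipH_inM, map_neg, prodDualJ_inT, prodDualJ_inM]

include Θ in
theorem complexify_conjFlip (x : VA F M ℂ) :
    complexify X.prodDualJ (conjFlip F M x) = conjFlip F M (complexify X.prodDualJ x) := by
  induction x using inclC_induction with
  | h0 => simp
  | ha x y hx hy => simp only [map_add, hx, hy]
  | ht z u =>
    rw [LinearMap.map_smul, conjFlip_smul, conjFlip_smul, LinearMap.map_smul, complexify_inclC, conjFlip_inclC,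
      conjFlip_inclC, complexify_inclC, prodDualJ_flipH Θ]

theorem conjFlip_mem_eigen {σ : K →+* ℂ} {z : ℂ} {x : VA F M ℂ}
    (hx : x ∈ Vsigma Θ D σ ⊓ (complexify X.prodDualJ).eigenspace z) :
    conjFlip F M x ∈ Vsigma Θ D σ ⊓ (complexify X.prodDualJ).eigenspace ((starRingEnd ℂ) z) := by
  refine ⟨conjFlip_mem_Vsigma Θ D hx.1, ?_⟩
  have h := Module.End.mem_eigenspace_iff.mp hx.2
  rw [SetLike.mem_coe, Module.End.mem_eigenspace_iff, complexify_conjFlip Θ, h, conjFlip_smul]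

/-- The antilinear involution `conjFlip` embeds one space in the other. It is only `ℝ`-linear, so
real dimensions are compared and halved. Taking `z = i` and `z = -i` gives equality. -/
theorem finrank_eigen_le (σ : K →+* ℂ) (z : ℂ) :
    Module.finrank ℂ ↥(Vsigma Θ D σ ⊓ (complexify X.prodDualJ).eigenspace z) ≤
      Module.finrank ℂ
        ↥(Vsigma Θ D σ ⊓ (complexify X.prodDualJ).eigenspace ((starRingEnd ℂ) z)) := by
  set Y := Vsigma Θ D σ ⊓ (complexify X.prodDualJ).eigenspace z
  set Y' := Vsigma Θ D σ ⊓ (complexify X.prodDualJ).eigenspace ((starRingEnd ℂ) z)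
  have : Module.Finite ℝ Y' := Module.Finite.trans ℂ Y'
  let f : Y →ₗ[ℝ] Y' :=
    { toFun := fun x => ⟨conjFlip F M x, conjFlip_mem_eigen Θ D x.2⟩
      map_add' := fun x y => Subtype.ext (map_add (conjFlip F M) _ _)
      map_smul' := fun c x => Subtype.ext (map_smul (conjFlip F M) c (x : VA F M ℂ)) }
  have hf : Function.Injective f := fun x y h => Subtype.ext (by
    have := congrArg (fun y : Y' => conjFlip F M (y : VA F M ℂ)) h
    simpa [f, conjFlip_conjFlip] using this)
  have h := LinearMap.finrank_le_finrank_of_injective hf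
  rw [← Module.finrank_mul_finrank ℝ ℂ Y, ← Module.finrank_mul_finrank ℝ ℂ Y',
    Complex.finrank_real_complex] at h
  omega

theorem finrank_eigen_add (σ : K →+* ℂ) :
    Module.finrank ℂ ↥(Vsigma Θ D σ ⊓ (complexify X.prodDualJ).eigenspace Complex.I) +
      Module.finrank ℂ ↥(Vsigma Θ D σ ⊓ (complexify X.prodDualJ).eigenspace (-Complex.I)) =
      Module.finrank F M := by
  rw [← finrank_Vsigma Θ D σ, ← Submodule.finrank_sup_add_finrank_inf_eq]
  have hinf : Vsigma Θ D σ ⊓ (complexify X.prodDualJ).eigenspace Complex.I ⊓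
      (Vsigma Θ D σ ⊓ (complexify X.prodDualJ).eigenspace (-Complex.I)) = ⊥ := by
    rw [eq_bot_iff]
    rintro x ⟨⟨-, h1⟩, -, h2⟩
    rw [SetLike.mem_coe, Module.End.mem_eigenspace_iff] at h1 h2
    rw [h1, neg_smul, ← sub_eq_zero, sub_neg_eq_add, ← add_smul, smul_eq_zero] at h2
    exact h2.resolve_left (by simp [Complex.ext_iff])
  have hsup : Vsigma Θ D σ ⊓ (complexify X.prodDualJ).eigenspace Complex.I ⊔
      (Vsigma Θ D σ ⊓ (complexify X.prodDualJ).eigenspace (-Complex.I)) = Vsigma Θ D σ := by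
    refine le_antisymm (sup_le inf_le_left inf_le_left) fun x hx => ?_
    have hI := complexify_mem_Vsigma Θ D hx
    have hII := complexify_prodDualJ_sq Θ x
    set y := complexify X.prodDualJ x with hy
    have e : x = (2 : ℂ)⁻¹ • (x - Complex.I • y) + (2 : ℂ)⁻¹ • (x + Complex.I • y) := by
      module
    rw [e]
    refine Submodule.add_mem_sup (Submodule.smul_mem _ _ ⟨?_, ?_⟩)
      (Submodule.smul_mem _ _ ⟨?_, ?_⟩)
    · exact sub_mem hx (Submodule.smul_mem _ _ hI)
    · rw [SetLike.mem_coe, Module.End.mem_eigenspace_iff, map_sub, map_smul, hII, ← hy, smul_sub,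
        smul_smul, Complex.I_mul_I]
      module
    · exact add_mem hx (Submodule.smul_mem _ _ hI)
    · rw [SetLike.mem_coe, Module.End.mem_eigenspace_iff, map_add, map_smul, hII, ← hy, smul_add,
        smul_smul, neg_mul, Complex.I_mul_I]
      module
  rw [hinf, hsup, finrank_bot, add_zero]

theorem hasWeilSignature : HasWeilSignature Θ D X.prodDualJ := by
  intro σ
  have : Module.Finite F M := Module.Finite.of_restrictScalars_finite ℚ F M
  have h1 := finrank_eigen_add Θ D σ
  have h2 := finrank_eigen_le Θ D σ Complex.I
  have h3 := finrank_eigen_le Θ D σ (-Complex.I)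
  rw [map_neg, Complex.conj_I, neg_neg] at h3
  rw [Complex.conj_I] at h2
  rw [Subspace.dual_finrank_eq]
  omega

theorem isPolarizedWeilType : IsPolarizedWeilType Θ D X.prodDualJ D.r where
  sq := prodDualJ_mul_self Θ
  commute := commute_prodDualJ_etaA Θ D
  signature := hasWeilSignature Θ D
  alt := Xi_isAlt Θ D
  adjoint := Xi_adjoint Θ D
  invariant := Xi_invariant Θ D
  pos := Xi_pos Θ D

theorem prodDualJ_mem_Omega : X.prodDualJ ∈ Omega Θ D D.r :=
  ⟨prodDualJ_mem_rhoSpinB Θ D, prodDualJ_mul_self Θ, hasWeilSignature Θ D, Xi_symm Θ D,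
    Xi_pos Θ D⟩

end Signature

/-! ### Symplectic bases -/

section Symplectic
variable {k N : Type*} [Field k] [AddCommGroup N] [Module k N]

/-- A symplectic family: `ω(e i, f j) = δ i j` and the `e i`, the `f i` span isotropic subspaces. -/
structure IsSymplectic (ω : N →ₗ[k] N →ₗ[k] k) {n : ℕ} (e f : Fin n → N) : Prop where
  left_left : ∀ i j, ω (e i) (e j) = 0
  right_right : ∀ i j, ω (f i) (f j) = 0
  left_right : ∀ i j, ω (e i) (f j) = if i = j then 1 else 0

variable {ω : N →ₗ[k] N →ₗ[k] k} (hω : ω.IsAlt) {n : ℕ} {e f : Fin n → N}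
include hω

theorem IsSymplectic.right_left (h : IsSymplectic ω e f) (i j : Fin n) :
    ω (f i) (e j) = -if i = j then 1 else 0 := by
  rw [← hω.neg, h.left_right]
  simp [eq_comm]

theorem IsSymplectic.linearIndependent (h : IsSymplectic ω e f) :
    LinearIndependent k (Sum.elim e f) := by
  rw [Fintype.linearIndependent_iff]
  intro g hg
  rw [Fintype.sum_sum_type] at hg
  simp only [Sum.elim_inl, Sum.elim_inr] at hg
  rintro (i | i)
  · have := congrArg (fun v => ω v (f i)) hg
    simpa [h.left_right, h.right_right] using this
  · have := congrArg (fun v => ω (e i) v) hg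
    simpa [h.left_right, h.left_left] using this

/-- Symplectic Gram–Schmidt: `p` projects onto the orthogonal complement of the span, which is
nonzero when the span is proper. -/
theorem IsSymplectic.extend (hinj : Function.Injective ω) (h : IsSymplectic ω e f)
    (hs : Submodule.span k (Set.range (Sum.elim e f)) ≠ ⊤) :
    ∃ e' f' : Fin (n + 1) → N, IsSymplectic ω e' f' := by
  let p : N → N := fun m => m - ∑ i, ω m (f i) • e i + ∑ i, ω m (e i) • f i
  have pe : ∀ m j, ω (p m) (e j) = 0 := by
    intro m j
    simp [p, h.left_left, h.right_left hω]
  have pf : ∀ m j, ω (p m) (f j) = 0 := by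
    intro m j
    simp [p, h.left_right, h.right_right]
  obtain ⟨m, hm⟩ : ∃ m, p m ≠ 0 := by
    by_contra! hp
    apply hs
    rw [eq_top_iff]
    rintro m -
    have : m = ∑ i, ω m (f i) • e i - ∑ i, ω m (e i) • f i := by
      have := hp m
      simp only [p] at this
      rw [← sub_eq_zero, ← this]
      abel
    rw [this]
    exact sub_mem (sum_mem fun i _ => Submodule.smul_mem _ _ (Submodule.subset_span ⟨Sum.inl i, rfl⟩))
      (sum_mem fun i _ => Submodule.smul_mem _ _ (Submodule.subset_span ⟨Sum.inr i, rfl⟩))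
  obtain ⟨l, hl⟩ : ∃ l, ω (p m) l ≠ 0 := by
    by_contra! h0
    exact hm (hinj (by ext l; simp [h0 l]))
  -- `l` and `p l` differ by an element of the span, to which `p m` is orthogonal; so a partner for
  -- `p m` exists inside the complement.
  have hl' : ω (p m) (p l) = ω (p m) l := by
    change ω (p m) (l - ∑ i, ω l (f i) • e i + ∑ i, ω l (e i) • f i) = _
    rw [map_add, map_sub, map_sum, map_sum]
    simp [pe, pf]
  have ep : ∀ m j, ω (e j) (p m) = 0 := fun m j => by rw [← hω.neg, pe, neg_zero]
  have fp : ∀ m j, ω (f j) (p m) = 0 := fun m j => by rw [← hω.neg, pf, neg_zero]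
  refine ⟨Fin.cons (p m) e, Fin.cons ((ω (p m) l)⁻¹ • p l) f, ⟨?_, ?_, ?_⟩⟩
  · intro i j
    refine Fin.cases ?_ (fun i => ?_) i <;> refine Fin.cases ?_ (fun j => ?_) j
    · simpa using hω (p m)
    · simpa using pe m j
    · simpa using ep m i
    · simpa using h.left_left i j
  · intro i j
    refine Fin.cases ?_ (fun i => ?_) i <;> refine Fin.cases ?_ (fun j => ?_) j
    · simp [hω (p l)]
    · simp [pf l j]
    · simp [fp l i]
    · simpa using h.right_right i j
  · intro i j
    refine Fin.cases ?_ (fun i => ?_) i <;> refine Fin.cases ?_ (fun j => ?_) j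
    · simp [hl', hl]
    · simpa [(Fin.succ_ne_zero j).symm] using pf m j
    · simp [ep l i]
    · simpa using h.left_right i j

/-- A nondegenerate alternating form has a symplectic basis. -/
theorem exists_isSymplectic [Module.Finite k N] (hinj : Function.Injective ω) :
    ∃ (n : ℕ) (e f : Fin n → N), IsSymplectic ω e f ∧ Module.finrank k N = n + n := by
  by_contra! hcon
  -- If no symplectic family spans, families extend indefinitely, contradicting the independence of
  -- their `2n` vectors in finite dimension.
  have key : ∀ n : ℕ, ∃ e f : Fin n → N, IsSymplectic ω e f := by
    intro n
    induction n with
    | zero => exact ⟨Fin.elim0, Fin.elim0, ⟨fun i => i.elim0, fun i => i.elim0, fun i => i.elim0⟩⟩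
    | succ n ih =>
      obtain ⟨e, f, h⟩ := ih
      refine h.extend hω hinj fun hs => hcon n e f h ?_
      rw [← finrank_top, ← hs, finrank_span_eq_card (h.linearIndependent hω)]
      simp
  obtain ⟨e, f, h⟩ := key (Module.finrank k N + 1)
  have := (h.linearIndependent hω).fintype_card_le_finrank
  simp at this
  omega

end Symplectic

/-! ### The hermitian form -/

section Hermitian
variable {F K M : Type*} [Field F] [NumberField F] [IsTotallyReal F] [Field K] [NumberField K]
  [IsTotallyComplex K] [Algebra F K] [Algebra.IsQuadraticExtension F K]
  [AddCommGroup M] [Module ℚ M] [Module F M] [Module.Finite ℚ M]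
  {X : Torus F M} (Θ : Polarization X) (D : ImagGenerator F K)

theorem Fpair_eta_r (x y : V F M) :
    Fpair F M x (eta Θ D D.r y) = -Fpair F M (eta Θ D D.r x) y := by
  obtain ⟨h, m⟩ := x
  obtain ⟨h', m'⟩ := y
  obtain ⟨n, rfl⟩ := Θ.contract.surjective h
  obtain ⟨n', rfl⟩ := Θ.contract.surjective h'
  simp [eta_r_apply, LinearMap.dualProd]
  simp only [Θ.contract_apply]
  rw [← Θ.alt.neg m, ← Θ.alt.neg n]
  ring

theorem eta_r_eta_r (x : V F M) : eta Θ D D.r (eta Θ D D.r x) = -(D.q • x) := by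
  rw [← Module.End.mul_apply, ← map_mul, ← sq, D.sq, map_neg, AlgHom.commutes,
    LinearMap.neg_apply, Module.algebraMap_end_apply]

theorem hermForm_r (x y : V F M) : hermForm Θ D D.r x y =
    algebraMap F K D.q * algebraMap F K (Fpair F M x y) +
      D.r * algebraMap F K (Fpair F M (eta Θ D D.r x) y) := by
  change -D.r ^ 2 * _ + _ = _
  rw [D.sq, neg_neg]

theorem hermForm_add_right (x y z : V F M) : hermForm Θ D D.r x (y + z : V F M) =
    hermForm Θ D D.r x y + hermForm Θ D D.r x z := by
  simp only [hermForm_r, map_add]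
  ring

theorem hermForm_add_left (x x' y : V F M) : hermForm Θ D D.r (x + x' : V F M) y =
    hermForm Θ D D.r x y + hermForm Θ D D.r x' y := by
  simp only [hermForm_r, map_add, LinearMap.add_apply]
  ring

/-- For `s = r`, skewness of `η_r` and `r² = -q` interchange the two terms of the form up to the
factor `r`. -/
theorem hermForm_eta_right (s : K) (x y : V F M) :
    hermForm Θ D D.r x (eta Θ D s y) = s * hermForm Θ D D.r x y := by
  obtain ⟨a, b, rfl⟩ := D.exists_coords s
  have hr : hermForm Θ D D.r x (eta Θ D D.r y) = D.r * hermForm Θ D D.r x y := by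
    rw [hermForm_r, hermForm_r, Fpair_eta_r, Fpair_eta_r, eta_r_eta_r, map_neg (Fpair F M),
      map_smul, LinearMap.neg_apply, LinearMap.smul_apply, neg_neg, map_neg, smul_eq_mul, map_mul]
    linear_combination -algebraMap F K (Fpair F M (eta Θ D D.r x) y) * D.sq
  have hF : ∀ (c : F) (z : V F M), hermForm Θ D D.r x (c • z : V F M) =
      algebraMap F K c * hermForm Θ D D.r x z := by
    intro c z
    simp only [hermForm_r, map_smul, smul_eq_mul, map_mul]
    ring
  rw [map_add, map_mul, AlgHom.commutes, AlgHom.commutes, LinearMap.add_apply,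
    Module.End.mul_apply, Module.algebraMap_end_apply, Module.algebraMap_end_apply,
    hermForm_add_right, hF, hF, hr]
  ring

theorem hermForm_eta_left (s : K) (x y : V F M) :
    hermForm Θ D D.r (eta Θ D s x) y = iota F K s * hermForm Θ D D.r x y := by
  obtain ⟨a, b, rfl⟩ := D.exists_coords s
  have hr : hermForm Θ D D.r (eta Θ D D.r x) y = -D.r * hermForm Θ D D.r x y := by
    rw [hermForm_r, hermForm_r, eta_r_eta_r, map_neg (Fpair F M),
      map_smul, LinearMap.neg_apply, LinearMap.smul_apply, map_neg, smul_eq_mul, map_mul]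
    linear_combination algebraMap F K (Fpair F M (eta Θ D D.r x) y) * D.sq
  have hF : ∀ (c : F) (z : V F M), hermForm Θ D D.r (c • z : V F M) y =
      algebraMap F K c * hermForm Θ D D.r z y := by
    intro c z
    simp only [hermForm_r, map_smul, LinearMap.smul_apply, smul_eq_mul, map_mul]
    ring
  rw [map_add, map_mul, AlgHom.commutes, AlgHom.commutes, LinearMap.add_apply,
    Module.End.mul_apply, Module.algebraMap_end_apply, Module.algebraMap_end_apply,
    hermForm_add_left, hF, hF, hr,
    map_add, map_mul, AlgEquiv.commutes, AlgEquiv.commutes, D.iota_r]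
  ring

/-- The hermitian form as a linear form in its second argument. -/
def hermLin (x : Veta Θ D) : Veta Θ D →ₗ[K] K where
  toFun := hermForm Θ D D.r x
  map_add' y z := hermForm_add_right Θ D x y z
  map_smul' s y := hermForm_eta_right Θ D s x y

theorem hermLin_add (x x' y : Veta Θ D) :
    hermLin Θ D (x + x') y = hermLin Θ D x y + hermLin Θ D x' y := hermForm_add_left Θ D x x' y

theorem hermLin_smul (s : K) (x y : Veta Θ D) :
    hermLin Θ D (s • x) y = iota F K s * hermLin Θ D x y := hermForm_eta_left Θ D s x y

theorem hermLin_sub (x x' y : Veta Θ D) :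
    hermLin Θ D (x - x') y = hermLin Θ D x y - hermLin Θ D x' y := by
  have := hermLin_add Θ D (x - x') x' y
  rw [sub_add_cancel] at this
  rw [this, add_sub_cancel_right]

/-- A vector of `H₁(X, ℚ)` in the `K`-vector space `V_η`. -/
def vecM (m : M) : Veta Θ D := ((0, m) : V F M)

/-- `H₁(X, ℚ)` is isotropic for the pairing, so only the `η_r`-term survives. Symplectic bases for
`Θ` thereby control the hermitian form. -/
theorem hermLin_vecM (m m' : M) : hermLin Θ D (vecM Θ D m) (vecM Θ D m') =
    D.r * algebraMap F K D.q * algebraMap F K (Θ.form m m') := by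
  change hermForm Θ D D.r ((0, m) : V F M) ((0, m') : V F M) = _
  rw [hermForm_r]
  simp [eta_r_apply, LinearMap.dualProd]
  ring

/-- A family with orthogonal relations for the hermitian form is linearly independent. -/
theorem linearIndependent_of_hermLin {n : Type*} [Fintype n] [DecidableEq n] (v w : n → Veta Θ D)
    (c : n → K) (hc : ∀ i, c i ≠ 0)
    (h : ∀ i j, hermLin Θ D (w i) (v j) = if i = j then c i else 0) : LinearIndependent K v := by
  rw [Fintype.linearIndependent_iff]
  intro g hg i
  have := congrArg (hermLin Θ D (w i)) hg
  simp only [map_sum, map_smul, h, map_zero] at this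
  simpa [hc i] using this

theorem isSplit : IsSplit Θ D (hermForm Θ D D.r) := by
  have : Module.Finite F M := Module.Finite.of_restrictScalars_finite ℚ F M
  obtain ⟨n, e, f, h, hn⟩ := exists_isSymplectic Θ.alt Θ.form_injective
  have hK : Module.finrank K (Veta Θ D) = n + n := by rw [finrank_Veta, hn]
  have hr : D.r ≠ 0 := fun h => D.r_notMem 0 (by rw [map_zero, h])
  -- Dividing the `f i` by `κ` normalizes the products with the `e i` to `1`. Since `ι κ = -κ`,
  -- semilinearity cancels the sign of `Θ(f, e) = -Θ(e, f)`, and each pair spans a hyperbolic plane.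
  set κ : K := D.r * algebraMap F K D.q with hκ
  have hκ0 : κ ≠ 0 := mul_ne_zero hr ((map_ne_zero _).mpr D.q_ne_zero)
  have hικ : iota F K κ⁻¹ = -κ⁻¹ := by
    rw [map_inv₀, hκ, map_mul, D.iota_r, AlgEquiv.commutes, neg_mul, inv_neg]
  set E : Fin n → Veta Θ D := fun i => vecM Θ D (e i) with hE
  set G : Fin n → Veta Θ D := fun i => κ⁻¹ • vecM Θ D (f i) with hG
  have hEE : ∀ i j, hermLin Θ D (E i) (E j) = 0 := fun i j => by
    simp [hE, hermLin_vecM, h.left_left]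
  have hEG : ∀ i j, hermLin Θ D (E i) (G j) = if i = j then 1 else 0 := fun i j => by
    rw [hE, hG, map_smul, hermLin_vecM, h.left_right, ← hκ]
    split_ifs <;> simp [hκ0]
  have hGE : ∀ i j, hermLin Θ D (G i) (E j) = if i = j then 1 else 0 := fun i j => by
    rw [hE, hG, hermLin_smul, hermLin_vecM, h.right_left Θ.alt, ← hκ, hικ]
    split_ifs <;> simp [hκ0]
  have hGG : ∀ i j, hermLin Θ D (G i) (G j) = 0 := fun i j => by
    simp [hG, hermLin_smul, hermLin_vecM, h.right_right]
  constructor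
  · refine ⟨Submodule.span K (Set.range E), ?_, ?_⟩
    · rw [hK, finrank_span_eq_card (linearIndependent_of_hermLin Θ D E G (fun _ => 1)
        (fun _ => one_ne_zero) hGE), Fintype.card_fin, two_mul]
    · have h1 : ∀ y ∈ Submodule.span K (Set.range E), ∀ i, hermLin Θ D (E i) y = 0 := by
        intro y hy i
        induction hy using Submodule.span_induction with
        | mem y hy => obtain ⟨j, rfl⟩ := hy; exact hEE i j
        | zero => simp
        | add y z _ _ hy hz => rw [map_add, hy, hz, add_zero]
        | smul s y _ hy => rw [map_smul, hy, smul_zero]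
      intro x hx y hy
      change hermLin Θ D x y = 0
      induction hx using Submodule.span_induction with
      | mem x hx => obtain ⟨i, rfl⟩ := hx; exact h1 y hy i
      | zero => simpa using hermLin_smul Θ D 0 0 y
      | add x z _ _ hx hz => rw [hermLin_add, hx, hz, add_zero]
      | smul s x _ hx => rw [hermLin_smul, hx, mul_zero]
  -- Each hyperbolic plane is diagonalized by the sum and difference of its isotropic basis, with
  -- values `2` and `-2`.
  · set v : Fin n ⊕ Fin n → Veta Θ D := Sum.elim (fun i => E i + G i) fun i => E i - G i with hv
    set c : Fin n ⊕ Fin n → F := Sum.elim (fun _ => 2) fun _ => -2 with hc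
    have hc0 : ∀ i, c i ≠ 0 := by rintro (i | i) <;> simp [hc]
    have h2K : algebraMap F K 2 = 2 := map_ofNat _ 2
    have hgram : ∀ i j, hermLin Θ D (v i) (v j) = if i = j then algebraMap F K (c i) else 0 := by
      rintro (i | i) (j | j) <;>
        simp only [hv, hc, Sum.elim_inl, Sum.elim_inr, hermLin_add, hermLin_sub, map_add, map_sub, map_neg,
          h2K, hEE, hEG, hGE, hGG, Sum.inl.injEq, Sum.inr.injEq, reduceCtorEq, if_false] <;>
        split_ifs <;> norm_num
    have hli := linearIndependent_of_hermLin Θ D v v _ (fun i => (map_ne_zero _).mpr (hc0 i)) hgram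
    let b := (basisOfLinearIndependentOfCardEqFinrank' v hli (by simp [hK]))
    have hb : ∀ i, b i = v i := fun i => by simp [b]
    refine ⟨n + n, b.reindex finSumFinEquiv, c ∘ finSumFinEquiv.symm, ?_, ?_, ?_, ?_⟩
    · intro i j hij
      change hermLin Θ D _ _ = 0
      rw [Module.Basis.reindex_apply, Module.Basis.reindex_apply, hb, hb, hgram, if_neg]
      simpa using hij
    · intro i
      refine ⟨hc0 _, ?_⟩
      change hermLin Θ D _ _ = _
      rw [Module.Basis.reindex_apply, hb, hgram, if_pos rfl]
      rfl
    · intro τ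
      -- Swapping the two halves of the basis matches the entries `2` with the entries `-2`.
      refine Nat.card_congr (Equiv.subtypeEquiv
        ((finSumFinEquiv.symm.trans (Equiv.sumComm _ _)).trans finSumFinEquiv) fun i => ?_)
      obtain ⟨i, rfl⟩ := finSumFinEquiv.surjective i
      simp only [Equiv.trans_apply, Equiv.symm_apply_apply, Function.comp_apply]
      rcases i with i | i <;> simp [hc]
    -- The discriminant is `2ⁿ (-2)ⁿ = (-1)ⁿ (2ⁿ)²`, and `(2ⁿ)²` is the norm of `2ⁿ`.
    · refine ⟨algebraMap F K (2 ^ n), by simp, ?_⟩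
      rw [Algebra.norm_algebraMap, Algebra.IsQuadraticExtension.finrank_eq_two]
      have h1 : ∏ i, (c ∘ finSumFinEquiv.symm) i = ∏ i, c i :=
        Fintype.prod_equiv finSumFinEquiv.symm _ _ fun _ => rfl
      have h2 : (n + n) / 2 = n := by omega
      rw [h1, Fintype.prod_sum_type, h2]
      simp only [hc, Sum.elim_inl, Sum.elim_inr, Finset.prod_const, Finset.card_univ,
        Fintype.card_fin]
      rw [← mul_pow, ← pow_mul, mul_comm n 2, pow_mul, ← mul_pow]
      norm_num

end Hermitian

end WeilType

end

/-! ### Conclusion, with `t = √-q` -/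

theorem mainTheorem10
    {F K M : Type*} [Field F] [NumberField F] [NumberField.IsTotallyReal F]
    [Field K] [NumberField K] [NumberField.IsTotallyComplex K]
    [Algebra F K] [Algebra.IsQuadraticExtension F K]
    [AddCommGroup M] [Module ℚ M] [Module F M] [Module.Finite ℚ M]
    (X : WeilType.Torus F M) (Θ : WeilType.Polarization X) (D : WeilType.ImagGenerator F K) :
    ∃ t : K, t ≠ 0 ∧ WeilType.iota F K t = -t ∧
      X.prodDualJ ∈ WeilType.Omega Θ D t ∧
      WeilType.IsPolarizedWeilType Θ D X.prodDualJ t ∧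
      WeilType.IsSplit Θ D (WeilType.hermForm Θ D t) :=
  ⟨D.r, fun h => D.r_notMem 0 (by rw [map_zero, h]), D.iota_r, WeilType.prodDualJ_mem_Omega Θ D,
    WeilType.isPolarizedWeilType Θ D, WeilType.isSplit Θ D⟩
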